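/- Let $n\ge 3$ be an integer, $p\in(0,n-2)$, $P\ge 2$ real and $R>0$. Let $\Lambda\subset S^{n-1}$ be an open set with connected (in particular non-empty) closure, and let $\lambda:S^{n-1}\to[0,\lambda_0]$ be continuous, positive on $\Lambda$ and zero outside $\Lambda$ (for instance $\lambda$ Lipschitz and vanishing linearly at a smooth boundary $\partial\Lambda$, or $\Lambda=S^{n-1}$ and $\lambda\equiv1$). Let $\Omega_R\subset\mathbb R^n$ be the part of the open cone over $\Lambda$ outside the closed ball of radius $R$, let $d\hat x$ be the surface measure on $S^{n-1}$, and put $$d\chi=\lambda^{2P}d\hat x,\qquad \mathrm{N}^\lambda=\int_\Lambda d\chi,\qquad \langle f\rangle=\frac{1}{\mathrm N^\lambda}\int_\Lambda f\,d\chi,\qquad \omega_p=\lambda^P r^{n/2-p},$$ $$a=2(n-2-p),\quad b=2+(n-3)(n-2-a),\quad c=a\bigl(1+(n-2)(n-2-a)\bigr),\quad d=\frac{(n-1)ab}{(n-2)^2+1},$$ $$\widetilde\alpha=\alpha(a-\alpha),\qquad D^\alpha=\frac{(n-1)\alpha(\widetilde\alpha+b)}{(n-2)(n-2-a+\alpha)+1},\qquad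 \zeta^\lambda=\frac{4}{(n-2)^2+1}\,\frac{|S^{n-1}|}{\mathrm N^\lambda}.$$ Let $H=H^2_{-P}(\Lambda)$ be the completion of the space of smooth functions on $\Lambda$ with finite norm $\|\nu\|^2=\int_\Lambda(\nu^2+|\nabla\nu|^2+|\nabla^2\nu|^2)\,d\chi$, where $\nabla$, $\nabla^2$ and $\Delta$ are the gradient, covariant Hessian and Laplacian of the unit sphere, and let $H^*$ be its dual. For $\alpha\in[a/2,a]$ consider $$A^{\lambda,\alpha}[\nu]=r^{4+\alpha}\,\mathcal H^\lambda[r^{-\alpha}\nu],\qquad \mathcal H^\lambda[u]=\omega_p^{-2}(\partial_i\partial_j-\delta_{ij}\Delta)\bigl(\omega_p^2(\partial_i\partial_ju-\delta_{ij}\Delta u)\bigr),$$ in weak form, that is, the bounded operator $A^{\lambda,\alpha}:H\to H^*$ given (after integration by parts of $\mu\,A^{\lambda,\alpha}[\nu]$) by $$A^{\lambda,\alpha}[\nu](\mu)=\Bigl\langle (n-2)\Delta\nu\,\Delta\mu+\nabla^2\nu\cdot\nabla^2\mu+2(1+a+\widetilde\alpha)\nabla\nu\cdot\nabla\mu-(a-\alpha)\bigl((n-2)(n-2-a+\alpha)+1\bigr)\mu\,\Delta\nu-\alpha\bigl((n-2)(n-2-\alpha)+1\bigr)\nu\,\Delta\mu+(n-1)\widetilde\alpha(\widetilde\alpha+b)\nu\mu\Bigr\rangle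 .$$ Assume the harmonic stability condition: for every $\alpha\in[a/2,a]$ there is $C>0$ such that every $\nu\in H$ with $\langle\Delta\nu-D^\alpha\nu\rangle=0$ satisfies $$\|\nu\|^2\le C\,\Bigl\langle (n-2)(\Delta\nu)^2+|\nabla^2\nu|^2+2(1+a+\widetilde\alpha)|\nabla\nu|^2-\bigl(c+2(n-2)\widetilde\alpha\bigr)\nu\Delta\nu+(n-1)\widetilde\alpha(\widetilde\alpha+b)\nu^2\Bigr\rangle .$$ Write $\operatorname{coker}A^{\lambda,\alpha}=\{\mu\in H:\ A^{\lambda,\alpha}[\nu](\mu)=0\text{ for all }\nu\in H\}$. Then: 1. For every $\alpha\in[a/2,a]$, the operator $A^{\lambda,\alpha}$ is indeed $r^{4+\alpha}\mathcal H^\lambda[r^{-\alpha}\,\cdot\,]$ in the variational sense in $\Omega_R$: for all smooth functions $\nu,\mu$ on $\Lambda$ belonging to $H$, all smooth $\psi$ with compact support in $(R,\infty)$, and $u=r^{-\alpha}\nu(x/r)$, $w=\psi(r)\mu(x/r)$, $$\int_{\Omega_R}(\partial_i\partial_ju-\delta_{ij}\Delta u)(\partial_i\partial_jw-\delta_{ij}\Delta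 w)\,\omega_p^2\,dx=\Bigl(\int_R^\infty\psi(r)\,r^{-4-\alpha}\,r^{n-2p}\,r^{n-1}dr\Bigr)\,\mathrm N^\lambda\,A^{\lambda,\alpha}[\nu](\mu).$$ 2. For every $\alpha\in[a/2,a)$, $A^{\lambda,\alpha}:H\to H^*$ is bijective, and $\ker A^{\lambda,\alpha}=\operatorname{coker}A^{\lambda,\alpha}=0$. 3. For $\alpha=a$, the cokernel is one-dimensional and consists of the constant functions, $\operatorname{coker}A^{\lambda,a}=\mathbb R\,1$; moreover the range of $A^{\lambda,a}$ is exactly $\{F\in H^*: F(1)=0\}$. 4. For $\alpha=a$, the average $\langle\Delta\nu-d\,\nu\rangle$ is non-zero for every non-zero $\nu\in\ker A^{\lambda,a}$, and $\ker A^{\lambda,a}=\mathbb R\,\nu^{\mathrm{norm}}$ is one-dimensional, where $\nu^{\mathrm{norm}}$ is the unique element of the kernel with $\langle\Delta\nu^{\mathrm{norm}}-d\,\nu^{\mathrm{norm}}\rangle=\zeta^\lambda$. -/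

import Mathlib

open MeasureTheory Set
open scoped ContDiff

noncomputable section

namespace HarmonicHamiltonian

/-! ### Numerical coefficients -/

/-- The harmonic exponent `a_{n,p}`. -/
def coefA (n : ℕ) (p : ℝ) : ℝ := 2 * ((n : ℝ) - 2 - p)

/-- The coefficient `b_{n,p}`. -/
def coefB (n : ℕ) (p : ℝ) : ℝ := 2 + ((n : ℝ) - 3) * ((n : ℝ) - 2 - coefA n p)

/-- The coefficient `c_{n,p}`. -/
def coefC (n : ℕ) (p : ℝ) : ℝ :=
  coefA n p * (1 + ((n : ℝ) - 2) * ((n : ℝ) - 2 - coefA n p))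

/-- The ADM mass coefficient `d_{n,p}`. -/
def coefD (n : ℕ) (p : ℝ) : ℝ :=
  ((n : ℝ) - 1) * coefA n p * coefB n p / (((n : ℝ) - 2) ^ 2 + 1)

/-- The coefficient `α (a_{n,p} - α)`. -/
def tildeAlpha (n : ℕ) (p α : ℝ) : ℝ := α * (coefA n p - α)

/-- The coefficient `D_{n,p}^α`. For `0 < p` and `a_{n,p} / 2 ≤ α` its denominator is positive. -/
def coefDalpha (n : ℕ) (p α : ℝ) : ℝ :=
  ((n : ℝ) - 1) * α * (α * (coefA n p - α) + coefB n p) /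
    (((n : ℝ) - 2) * ((n : ℝ) - 2 - coefA n p + α) + 1)

/-! ### Functions on the unit sphere and their derivatives -/

/-- The Euclidean space `ℝⁿ`. -/
abbrev Euc (n : ℕ) : Type := EuclideanSpace ℝ (Fin n)

/-- The unit sphere `S^{n-1} ⊂ ℝⁿ`. -/
abbrev Sph (n : ℕ) : Type := Metric.sphere (0 : Euc n) 1

/-- Standard surface measure on the unit sphere. -/
abbrev surf (n : ℕ) : Measure (Sph n) := (volume : Measure (Euc n)).toSphere

/-- The extension `x ↦ f (x / |x|)` of a function on the sphere (with value `0` at the origin). -/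
def ext {n : ℕ} (f : Sph n → ℝ) (x : Euc n) : ℝ :=
  if h : x ≠ 0 then f ⟨‖x‖⁻¹ • x, by simp [norm_smul, norm_ne_zero_iff.mpr h]⟩ else 0

/-- The open cone over a subset of the sphere (without its tip). -/
def cone {n : ℕ} (Λ : Set (Sph n)) : Set (Euc n) :=
  {x | ∃ r : ℝ, 0 < r ∧ ∃ θ ∈ Λ, x = r • (θ : Euc n)}

/-- The conical domain `Ω_R`: the part of the cone over `Λ` outside the closed ball of radius
`R`. -/
def conicalDomain {n : ℕ} (Λ : Set (Sph n)) (R : ℝ) : Set (Euc n) :=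
  cone Λ ∩ (Metric.closedBall 0 R)ᶜ

/-- Smoothness of a function on an open subset `Λ` of the sphere. -/
def SmoothOn {n : ℕ} (Λ : Set (Sph n)) (f : Sph n → ℝ) : Prop :=
  ContDiffOn ℝ ∞ (ext f) (cone Λ)

/-- The Euclidean Hessian matrix `∂_i ∂_j u`. -/
def hessE {n : ℕ} (u : Euc n → ℝ) (x : Euc n) : Matrix (Fin n) (Fin n) ℝ :=
  Matrix.of fun i j =>
    fderiv ℝ (fun y => fderiv ℝ u y (EuclideanSpace.single j 1)) x (EuclideanSpace.single i 1)

/-- The orthogonal projection matrix onto the tangent space of the sphere at `θ`. -/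
def tangentProj {n : ℕ} (θ : Sph n) : Matrix (Fin n) (Fin n) ℝ :=
  1 - Matrix.vecMulVec (fun i => (θ : Euc n) i) (fun i => (θ : Euc n) i)

/-- The gradient on the sphere, as a vector of `ℝⁿ`. The extension `ext f` has no radial
derivative, so its Euclidean gradient at a point of the sphere is tangential. -/
def sphGrad {n : ℕ} (f : Sph n → ℝ) (θ : Sph n) : Euc n := gradient (ext f) (θ : Euc n)

/-- The covariant Hessian on the sphere, as an `n × n` matrix. Since `ext f` has no radial
derivative, it is the tangential part of the Euclidean Hessian of `ext f`. -/
def sphHess {n : ℕ} (f : Sph n → ℝ) (θ : Sph n) : Matrix (Fin n) (Fin n) ℝ :=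
  tangentProj θ * hessE (ext f) (θ : Euc n) * tangentProj θ

/-! ### The weighted Sobolev space -/

/-- The localization function `lam` on the sphere, with support set `Λ`: it is continuous, takes
values in `(0, lam₀]` on `Λ` and vanishes elsewhere, and `Λ` is an open set with connected closure
(in particular it is not empty). -/
structure IsLocalization {n : ℕ} (Λ : Set (Sph n)) (lam : Sph n → ℝ) (lam₀ : ℝ) : Prop where
  isOpen : IsOpen Λ
  isConnected_closure : IsConnected (closure Λ)
  continuous : Continuous lam
  pos : ∀ θ ∈ Λ, 0 < lam θ
  le : ∀ θ ∈ Λ, lam θ ≤ lam₀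
  eq_zero : ∀ θ ∉ Λ, lam θ = 0

/-- The weighted measure `dχ = lam^{2P} dx̂` on the sphere. -/
def chi {n : ℕ} (lam : Sph n → ℝ) (P : ℝ) : Measure (Sph n) :=
  (surf n).withDensity fun θ => ENNReal.ofReal (lam θ ^ (2 * P))

/-- Triples (value, gradient, Hessian), with the Hilbert norm
`|value|² + |gradient|² + |Hessian|²` (Frobenius norm on matrices). -/
abbrev Jet (n : ℕ) : Type :=
  WithLp 2 (ℝ × WithLp 2 (Euc n × EuclideanSpace ℝ (Fin n × Fin n)))

/-- The triple formed by a function on the sphere, its gradient and its Hessian at `θ`. -/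
def jet {n : ℕ} (f : Sph n → ℝ) (θ : Sph n) : Jet n :=
  WithLp.toLp 2 (f θ, WithLp.toLp 2 (sphGrad f θ,
    WithLp.toLp 2 fun ij : Fin n × Fin n => sphHess f θ ij.1 ij.2))

/-- The weighted Sobolev space `H²_{-P}(Λ)`, that is, the completion of the space of smooth
functions on `Λ` with finite norm `(∫ (f² + |∇f|² + |∇²f|²) dχ)^{1/2}`. It is realized
as the closure, in `L²(dχ)`, of the set of the triples `(f, ∇f, ∇²f)`. -/
def h2Space {n : ℕ} (Λ : Set (Sph n)) (lam : Sph n → ℝ) (P : ℝ) :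
    Submodule ℝ (Lp (Jet n) 2 (chi lam P)) :=
  (Submodule.span ℝ {j : Lp (Jet n) 2 (chi lam P) |
    ∃ f : Sph n → ℝ, SmoothOn Λ f ∧ (j : Sph n → Jet n) =ᵐ[chi lam P] jet f}).topologicalClosure

/-- The elements of `H²_{-P}(Λ)`. -/
abbrev H2 {n : ℕ} (Λ : Set (Sph n)) (lam : Sph n → ℝ) (P : ℝ) : Type := ↥(h2Space Λ lam P)

section Components

variable {n : ℕ} {Λ : Set (Sph n)} {lam : Sph n → ℝ} {P : ℝ}

/-- The element `ν` of `H²_{-P}(Λ)` is the smooth function `f` on `Λ`. -/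
def IsSmoothFun (ν : H2 Λ lam P) (f : Sph n → ℝ) : Prop :=
  SmoothOn Λ f ∧ ((ν : Lp (Jet n) 2 (chi lam P)) : Sph n → Jet n) =ᵐ[chi lam P] jet f

/-- The function `ν` itself. -/
def val : H2 Λ lam P →L[ℝ] Lp ℝ 2 (chi lam P) :=
  ((WithLp.fstL 2 ℝ ℝ _ : Jet n →L[ℝ] ℝ).compLpL 2 (chi lam P)).comp (Submodule.subtypeL _)

/-- The gradient of `ν`. -/
def grad : H2 Λ lam P →L[ℝ] Lp (Euc n) 2 (chi lam P) :=
  (((WithLp.fstL 2 ℝ _ _).comp (WithLp.sndL 2 ℝ _ _) : Jet n →L[ℝ] Euc n).compLpL 2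
    (chi lam P)).comp (Submodule.subtypeL _)

/-- The Hessian of `ν`. -/
def hess : H2 Λ lam P →L[ℝ] Lp (EuclideanSpace ℝ (Fin n × Fin n)) 2 (chi lam P) :=
  (((WithLp.sndL 2 ℝ _ _).comp (WithLp.sndL 2 ℝ _ _) :
    Jet n →L[ℝ] EuclideanSpace ℝ (Fin n × Fin n)).compLpL 2 (chi lam P)).comp (Submodule.subtypeL _)

/-- The Laplacian of `ν`, the trace of its Hessian. -/
def lap : H2 Λ lam P →L[ℝ] Lp ℝ 2 (chi lam P) :=
  ((∑ i, EuclideanSpace.proj (i, i) :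
    EuclideanSpace ℝ (Fin n × Fin n) →L[ℝ] ℝ).compLpL 2 (chi lam P)).comp hess

/-- The bilinear form `(ν, μ) ↦ ∫ ⟨S ν, T μ⟩ dχ`. -/
def pairing {V : Type} [NormedAddCommGroup V] [InnerProductSpace ℝ V]
    (S T : H2 Λ lam P →L[ℝ] Lp V 2 (chi lam P)) : H2 Λ lam P →L[ℝ] H2 Λ lam P →L[ℝ] ℝ :=
  ContinuousLinearMap.bilinearComp (innerSL ℝ) S T

end Components

/-! ### The harmonic Hamiltonian operators and the stability condition -/

/-- The operator `A^{λ,α} : H²_{-P}(Λ) → (H²_{-P}(Λ))*`, namely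
`A^{λ,α}[ν](μ) = ⨍ μ A^{λ,α}[ν] dχ` where, in the right-hand side,
```
A^{λ,α}[ν] = (n-2) λ^{-2P} Δ(λ^{2P} Δν) + λ^{-2P} ∇^a ∇^b (λ^{2P} ∇_a ∇_b ν)
  - 2 (a + 1 + α(a-α)) λ^{-2P} ∇·(λ^{2P} ∇ν) - (a-α) ((n-2)(n-2-a+α) + 1) Δν
  - α ((n-2)(n-2-α) + 1) λ^{-2P} Δ(λ^{2P} ν) + (n-1) α(a-α) (α(a-α) + b) ν
```
and the derivatives falling on `λ^{2P}` have been integrated by parts. -/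
def hamOp {n : ℕ} (p P : ℝ) (Λ : Set (Sph n)) (lam : Sph n → ℝ) (α : ℝ) :
    H2 Λ lam P →L[ℝ] H2 Λ lam P →L[ℝ] ℝ :=
  ((chi lam P).real univ)⁻¹ •
    (((n : ℝ) - 2) • pairing lap lap
      + pairing hess hess
      + (2 * (coefA n p + 1 + tildeAlpha n p α)) • pairing grad grad
      - ((coefA n p - α) * (((n : ℝ) - 2) * ((n : ℝ) - 2 - coefA n p + α) + 1)) • pairing lap val
      - (α * (((n : ℝ) - 2) * ((n : ℝ) - 2 - α) + 1)) • pairing val lap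
      + (((n : ℝ) - 1) * tildeAlpha n p α * (tildeAlpha n p α + coefB n p)) • pairing val val)

/-- The quadratic functional associated with the exponent `α` (an average with respect to
`dχ`). -/
def quadForm {n : ℕ} (p P : ℝ) {Λ : Set (Sph n)} {lam : Sph n → ℝ} (α : ℝ)
    (ν : H2 Λ lam P) : ℝ :=
  ⨍ θ, (((n : ℝ) - 2) * (lap ν θ) ^ 2
      + ‖hess ν θ‖ ^ 2
      + 2 * (1 + coefA n p + tildeAlpha n p α) * ‖grad ν θ‖ ^ 2
      - (coefC n p + 2 * ((n : ℝ) - 2) * tildeAlpha n p α) * (val ν θ * lap ν θ)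
      + ((n : ℝ) - 1) * tildeAlpha n p α * (tildeAlpha n p α + coefB n p) * (val ν θ) ^ 2)
    ∂(chi lam P)

/-- The harmonic stability condition for the Hamiltonian. -/
def HarmonicStability {n : ℕ} (p P : ℝ) (Λ : Set (Sph n)) (lam : Sph n → ℝ) : Prop :=
  ∀ α ∈ Icc (coefA n p / 2) (coefA n p), ∃ C : ℝ, 0 < C ∧ ∀ ν : H2 Λ lam P,
    ⨍ θ, (lap ν θ - coefDalpha n p α * val ν θ) ∂(chi lam P) = 0 →
      ‖ν‖ ^ 2 ≤ C * quadForm p P α ν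

/-- The normalization constant `ζ^λ`. -/
def zeta {n : ℕ} (P : ℝ) (lam : Sph n → ℝ) : ℝ :=
  4 / (((n : ℝ) - 2) ^ 2 + 1) * ((surf n).real univ / (chi lam P).real univ)

/-! ### The squared localized Hamiltonian operator in the conical domain -/

/-- The variational weight `ω_p = λ^P r^{n/2-p}`. -/
def omega {n : ℕ} (p P : ℝ) (lam : Sph n → ℝ) (x : Euc n) : ℝ :=
  (ext lam x) ^ P * ‖x‖ ^ ((n : ℝ) / 2 - p)

/-- The adjoint of the Hamiltonian operator linearized at the Euclidean metric:
`u ↦ ∂_i ∂_j u - δ_{ij} Δu`. -/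
def dHstar {n : ℕ} (u : Euc n → ℝ) (x : Euc n) : Matrix (Fin n) (Fin n) ℝ :=
  hessE u x - (hessE u x).trace • 1

/-- The variational form of the squared localized Hamiltonian operator
`u ↦ ω_p^{-2} (∂_i ∂_j - δ_{ij} Δ) (ω_p² (∂_i ∂_j u - δ_{ij} Δu))` in `Ω_R`: the product of this
operator applied to `u` with the test function `w`, integrated with respect to `ω_p² dx`. -/
def hamVar {n : ℕ} (p P : ℝ) (Λ : Set (Sph n)) (lam : Sph n → ℝ) (R : ℝ)
    (u w : Euc n → ℝ) : ℝ :=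
  ∫ x in conicalDomain Λ R, (∑ i, ∑ j, dHstar u x i j * dHstar w x i j) * omega p P lam x ^ 2

/-- `A[ν] = r^{4+α} H^λ[r^{-α} ν]` in the variational sense, `H^λ` denoting the squared localized
Hamiltonian operator in `Ω_R`: when `H^λ[r^{-α} ν] = r^{-4-α} A[ν]` is multiplied by
`w = ψ(r) μ(x/r)` and integrated with respect to `ω_p² dx = dχ r^{n-2p} r^{n-1} dr`, the two sides
agree. -/
def IsHamiltonianAt {n : ℕ} (p P : ℝ) (Λ : Set (Sph n)) (lam : Sph n → ℝ) (R α : ℝ)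
    (A : H2 Λ lam P →L[ℝ] H2 Λ lam P →L[ℝ] ℝ) : Prop :=
  ∀ (ν μ : H2 Λ lam P) (f g : Sph n → ℝ), IsSmoothFun ν f → IsSmoothFun μ g →
    ∀ ψ : ℝ → ℝ, ContDiff ℝ ∞ ψ → HasCompactSupport ψ → tsupport ψ ⊆ Ioi R →
      hamVar p P Λ lam R (fun x => ‖x‖ ^ (-α) * ext f x) (fun x => ψ ‖x‖ * ext g x) =
        (∫ r in Ioi R, ψ r * r ^ (-4 - α) * r ^ ((n : ℝ) - 2 * p) * r ^ ((n : ℝ) - 1)) *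
          ((chi lam P).real univ * A ν μ)

end HarmonicHamiltonian

end

noncomputable section

namespace HarmonicHamiltonian

/-! ### Bilinear forms that are coercive on a hyperplane -/

section Abstract

variable {H : Type*} [NormedAddCommGroup H] [InnerProductSpace ℝ H]
  {B : H →L[ℝ] H →L[ℝ] ℝ} {l : H →L[ℝ] ℝ} {e : H} {k C : ℝ}

/-! Fix `α` and write `B` for the form `hamOp`, `l` for the functional `ν ↦ ⟨Δν - D^α ν⟩`, and `e`
for the constant function 1. Three facts drive the functional analysis. The diagonal `B ν ν` is the
stability functional (`quadForm_eq`), so harmonic stability says that `B` is coercive on the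
hyperplane `ker l`. Testing against `e` kills every term that differentiates the test function, and
`D^α` is exactly the ratio for which `B ν e = k * l ν`, with `k = -(a-α)((n-2)(n-2-a+α)+1)`
(`hamOp_apply_one`). Finally `l e = -D^α` is non-zero: otherwise `e` would lie in the hyperplane
with `B e e = 0`, contradicting coercivity (`coefDalpha_ne_zero`). Hence `H` is the sum of `ker l`
and `ℝ e`.

Lax–Milgram solves `B v = F` tested on `ker l`; only the test against `e` remains. For `α < a` one
has `k ≠ 0`, so adding a multiple of `e` adjusts it, and `B` is bijective. For `α = a` one has `k =
0`: the constants lie in the cokernel, coercivity leaves nothing else there, and `F e = 0` is the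
only obstruction to solvability. Correcting `e` by an element of `ker l` produces a kernel element
on which `l` is non-zero, and `l` is injective on the kernel; as `D^a = d`, this `l` is the
normalizing average.

The variational identity is a separate computation. In polar coordinates the Hessian of a radial
multiple of an angular function splits into radial, mixed and tangential blocks (`polarMatrix`), so
the integrand is a sum of radial times angular factors (`sum_dHstar_mul_dHstar`). Fubini separates
them, integration by parts in `r` moves the derivatives off `ψ`, and a polynomial identity
(`hamOp_algebra`) recovers the coefficients of `hamOp`. No integration by parts on the sphere is
needed, because the weak form keeps the angular derivatives on both arguments. -/

/-- The Lax–Milgram theorem on the kernel of a continuous functional. -/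
theorem exists_solution_on_ker [CompleteSpace H] (hC : 0 < C)
    (hB : ∀ v, l v = 0 → ‖v‖ ^ 2 ≤ C * B v v)
    (F : H →L[ℝ] ℝ) : ∃ v, l v = 0 ∧ ∀ w, l w = 0 → B v w = F w := by
  let V : Submodule ℝ H := l.ker
  have : CompleteSpace V := l.isClosed_ker.completeSpace_coe
  let BV : V →L[ℝ] V →L[ℝ] ℝ := B.bilinearComp V.subtypeL V.subtypeL
  have hco : IsCoercive BV := by
    refine ⟨C⁻¹, inv_pos.2 hC, fun u => ?_⟩
    have h := hB u u.2
    change C⁻¹ * ‖(u : H)‖ * ‖(u : H)‖ ≤ B u u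
    rw [mul_assoc, ← sq, inv_mul_le_iff₀ hC]
    exact h
  let f : V := (InnerProductSpace.toDual ℝ V).symm (F.comp V.subtypeL)
  refine ⟨(hco.continuousLinearEquivOfBilin.symm f : V),
    (hco.continuousLinearEquivOfBilin.symm f).2,
    fun w hw => ?_⟩
  have h := hco.continuousLinearEquivOfBilin_apply (hco.continuousLinearEquivOfBilin.symm f) ⟨w, hw⟩
  rw [ContinuousLinearEquiv.apply_symm_apply] at h
  have h2 : inner ℝ f ⟨w, hw⟩ = F w := by simp [f]
  rw [← h2, h]
  rfl

theorem eq_zero_of_coercive_on_ker (hB : ∀ v, l v = 0 → ‖v‖ ^ 2 ≤ C * B v v) {v : H}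
    (hv : l v = 0) (h : B v v = 0) : v = 0 := by
  have := hB v hv
  rw [h, mul_zero] at this
  exact norm_eq_zero.1 (pow_eq_zero_iff two_ne_zero |>.1 (le_antisymm this (sq_nonneg _)))

/-- Splitting along the kernel of a functional. -/
theorem exists_eq_add_smul (he : l e ≠ 0) (v : H) : ∃ w, ∃ t : ℝ, l w = 0 ∧ v = w + t • e := by
  refine ⟨v - (l v / l e) • e, l v / l e, ?_, by simp⟩
  simp [he]

/-- A kernel element satisfies `k * l v = 0`, hence lies in the coercive hyperplane and vanishes.
For surjectivity, the direction `e` supplies the one degree of freedom missing from the hyperplane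
problem. -/
theorem bijective_of_coercive_on_ker [CompleteSpace H] (hC : 0 < C)
    (hB : ∀ v, l v = 0 → ‖v‖ ^ 2 ≤ C * B v v)
    (he : l e ≠ 0) (hk : k ≠ 0) (hBe : ∀ v, B v e = k * l v) :
    Function.Bijective B ∧ B.ker = ⊥ ∧ B.flip.ker = ⊥ := by
  have hinj : ∀ v, B v = 0 → v = 0 := by
    intro v hv
    have h1 : l v = 0 := by
      have := hBe v
      rw [hv] at this
      simpa [hk] using this.symm
    exact eq_zero_of_coercive_on_ker hB h1 (by rw [hv]; rfl)
  have hsurj : Function.Surjective B := by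
    intro F
    -- The value forced by testing against `e`, since `B (v + s • e) e = s * k * l e` when `l v =
    -- 0`. Subtracting `s • B e` from `F` compensates for it on the hyperplane.
    let s := F e / (k * l e)
    obtain ⟨v, hv, hvw⟩ := exists_solution_on_ker hC hB (F - s • B e)
    refine ⟨v + s • e, ?_⟩
    ext w
    obtain ⟨w', t, hw', rfl⟩ := exists_eq_add_smul he w
    have h1 := hvw w' hw'
    have h2 : s * (k * l e) = F e := div_mul_cancel₀ _ (mul_ne_zero hk he)
    simp only [map_add, map_smul, add_apply, smul_apply, sub_apply, smul_eq_mul, hBe, hv] at h1 ⊢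
    rw [h1]
    linear_combination t * h2
  refine ⟨⟨(injective_iff_map_eq_zero B).2 hinj, hsurj⟩, ?_, ?_⟩
  · rw [eq_bot_iff]
    exact fun v hv => hinj v hv
  · rw [eq_bot_iff]
    intro v hv
    -- Representing the functional `⟨v, ·⟩` as some `B w` turns membership in the cokernel into `⟨v,
    -- v⟩ = 0`.
    obtain ⟨w, hw⟩ := hsurj (innerSL ℝ v)
    have h : B w v = 0 := DFunLike.congr_fun (show B.flip v = 0 from hv) w
    rw [hw] at h
    exact inner_self_eq_zero.1 h

/-- Since `B w e = 0`, testing a cokernel element `w + t • e` against its own hyperplane component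
gives `B w w = 0`, hence `w = 0`. -/
theorem flip_ker_of_coercive_on_ker (hB : ∀ v, l v = 0 → ‖v‖ ^ 2 ≤ C * B v v)
    (he : l e ≠ 0) (hBe : ∀ v, B v e = 0) : B.flip.ker = Submodule.span ℝ {e} := by
  apply le_antisymm
  · intro v hv
    obtain ⟨w, t, hw, rfl⟩ := exists_eq_add_smul he v
    have h : B w (w + t • e) = 0 := DFunLike.congr_fun (show B.flip (w + t • e) = 0 from hv) w
    have h0 : B w w = 0 := by simpa [hBe] using h
    rw [eq_zero_of_coercive_on_ker hB hw h0, zero_add]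
    exact Submodule.smul_mem _ _ (Submodule.mem_span_singleton_self e)
  · rw [Submodule.span_singleton_le_iff_mem]
    change B.flip e = 0
    ext v
    exact hBe v

theorem range_iff_of_coercive_on_ker [CompleteSpace H] (hC : 0 < C)
    (hB : ∀ v, l v = 0 → ‖v‖ ^ 2 ≤ C * B v v)
    (he : l e ≠ 0) (hBe : ∀ v, B v e = 0) (F : H →L[ℝ] ℝ) : (∃ v, B v = F) ↔ F e = 0 := by
  constructor
  · rintro ⟨v, rfl⟩
    exact hBe v
  · intro hF
    obtain ⟨v, -, hvw⟩ := exists_solution_on_ker hC hB F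
    refine ⟨v, ?_⟩
    ext w
    obtain ⟨w', t, hw', rfl⟩ := exists_eq_add_smul he w
    simp [hvw w' hw', hBe, hF]

theorem apply_ne_zero_of_mem_ker (hB : ∀ v, l v = 0 → ‖v‖ ^ 2 ≤ C * B v v) {v : H}
    (hv : B v = 0) (hv0 : v ≠ 0) : l v ≠ 0 := fun h =>
  hv0 (eq_zero_of_coercive_on_ker hB h (by rw [hv]; rfl))

/-- The generator is `e` plus a hyperplane correction that cancels `B e` on `ker l`; the test
against `e` vanishes automatically. Any two kernel elements with equal `l` differ by a kernel
element in the coercive hyperplane, so they coincide. -/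
theorem exists_ker_generator [CompleteSpace H] (hC : 0 < C)
    (hB : ∀ v, l v = 0 → ‖v‖ ^ 2 ≤ C * B v v)
    (he : l e ≠ 0) (hBe : ∀ v, B v e = 0) {z : ℝ} (hz : z ≠ 0) :
    ∃ v, v ≠ 0 ∧ B.ker = Submodule.span ℝ {v} ∧ l v = z ∧
      ∀ w, B w = 0 → l w = z → w = v := by
  obtain ⟨v₀, hv₀, hv₀w⟩ := exists_solution_on_ker hC hB (-B e)
  have hker : B (v₀ + e) = 0 := by
    ext w
    obtain ⟨w', t, hw', rfl⟩ := exists_eq_add_smul he w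
    simp [hv₀w w' hw', hBe]
  have hl : l (v₀ + e) = l e := by simp [hv₀]
  let v := (z / l e) • (v₀ + e)
  have hBv : B v = 0 := by simp only [v, map_smul, hker, smul_zero]
  have hlv : l v = z := by simp only [v, map_smul, hl, smul_eq_mul]; field_simp
  have huniq : ∀ w, B w = 0 → w = (l w / z) • v := by
    intro w hw
    have h0 : B (w - (l w / z) • v) = 0 := by simp [hw, hBv]
    by_contra hne
    exact apply_ne_zero_of_mem_ker hB h0 (sub_ne_zero.2 hne) (by simp [hlv, hz])
  refine ⟨v, ?_, ?_, hlv, ?_⟩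
  · intro h
    rw [h, map_zero] at hlv
    exact hz hlv.symm
  · apply le_antisymm
    · intro w hw
      rw [huniq w hw]
      exact Submodule.smul_mem _ _ (Submodule.mem_span_singleton_self v)
    · rw [Submodule.span_singleton_le_iff_mem]
      exact hBv
  · intro w hw hlw
    rw [huniq w hw, hlw, div_self hz, one_smul]

end Abstract

/-! ### The weighted measure -/

section Measure

variable {n : ℕ} {Λ : Set (Sph n)} {lam : Sph n → ℝ} {lam₀ P : ℝ}

namespace IsLocalization

theorem nonneg (h : IsLocalization Λ lam lam₀) (θ : Sph n) : 0 ≤ lam θ := by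
  by_cases hθ : θ ∈ Λ
  · exact (h.pos θ hθ).le
  · exact (h.eq_zero θ hθ).ge

theorem continuous_weight (h : IsLocalization Λ lam lam₀) (hP : 0 ≤ P) :
    Continuous fun θ => lam θ ^ (2 * P) :=
  h.continuous.rpow_const fun _ => Or.inr (by positivity)

theorem isFiniteMeasure_chi (h : IsLocalization Λ lam lam₀) (hP : 0 ≤ P) :
    IsFiniteMeasure (chi lam P) := by
  obtain ⟨C, hC⟩ := (isCompact_univ (X := Sph n)).bddAbove_image
    (h.continuous_weight hP).continuousOn
  refine isFiniteMeasure_withDensity (ne_of_lt ?_)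
  calc ∫⁻ θ, ENNReal.ofReal (lam θ ^ (2 * P)) ∂surf n
      ≤ ∫⁻ _, ENNReal.ofReal C ∂surf n := by
        refine lintegral_mono fun θ => ENNReal.ofReal_le_ofReal (hC ⟨θ, mem_univ _, rfl⟩)
    _ < ⊤ := by
        rw [lintegral_const]
        exact ENNReal.mul_lt_top ENNReal.ofReal_lt_top (measure_lt_top _ _)

/-- A connected closure is non-empty, so `Λ` is a non-empty open set; it has positive surface
measure and the density is positive on it. -/
theorem chi_univ_ne_zero (h : IsLocalization Λ lam lam₀) (hP : 0 ≤ P) :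
    chi lam P univ ≠ 0 := by
  intro h0
  have hne : Λ.Nonempty := closure_nonempty_iff.1 h.isConnected_closure.nonempty
  have h1 : chi lam P Λ = 0 := measure_mono_null (subset_univ _) h0
  have hm : Measurable fun θ => ENNReal.ofReal (lam θ ^ (2 * P)) :=
    (h.continuous_weight hP).measurable.ennreal_ofReal
  rw [chi, withDensity_apply_eq_zero hm] at h1
  have h2 : {θ | ENNReal.ofReal (lam θ ^ (2 * P)) ≠ 0} ∩ Λ = Λ := by
    refine inter_eq_right.2 fun θ hθ => ?_
    simpa using Real.rpow_pos_of_pos (h.pos θ hθ) _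
  rw [h2] at h1
  exact h.isOpen.measure_ne_zero _ hne h1

theorem chi_real_univ_pos (h : IsLocalization Λ lam lam₀) (hP : 0 ≤ P) :
    0 < (chi lam P).real univ := by
  have := h.isFiniteMeasure_chi hP
  exact ENNReal.toReal_pos (h.chi_univ_ne_zero hP) (measure_ne_top _ _)

end IsLocalization

end Measure

/-! ### Components of elements of the weighted Sobolev space -/

section Space

variable {n : ℕ} {Λ : Set (Sph n)} {lam : Sph n → ℝ} {lam₀ P p α : ℝ}

instance : CompleteSpace (H2 Λ lam P) :=
  (Submodule.isClosed_topologicalClosure _).completeSpace_coe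

theorem val_ae (ν : H2 Λ lam P) : (val ν : Sph n → ℝ) =ᵐ[chi lam P]
    fun θ => ((ν : Lp (Jet n) 2 (chi lam P)) θ).fst :=
  ContinuousLinearMap.coeFn_compLpL _ _

theorem grad_ae (ν : H2 Λ lam P) : (grad ν : Sph n → Euc n) =ᵐ[chi lam P]
    fun θ => ((ν : Lp (Jet n) 2 (chi lam P)) θ).snd.fst :=
  ContinuousLinearMap.coeFn_compLpL _ _

theorem hess_ae (ν : H2 Λ lam P) : (hess ν : Sph n → EuclideanSpace ℝ (Fin n × Fin n))
    =ᵐ[chi lam P] fun θ => ((ν : Lp (Jet n) 2 (chi lam P)) θ).snd.snd :=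
  ContinuousLinearMap.coeFn_compLpL _ _

theorem lap_ae (ν : H2 Λ lam P) : (lap ν : Sph n → ℝ) =ᵐ[chi lam P]
    fun θ => ∑ i, hess ν θ (i, i) := by
  filter_upwards [ContinuousLinearMap.coeFn_compLpL (p := 2) (μ := chi lam P)
    (∑ i, EuclideanSpace.proj (i, i) : EuclideanSpace ℝ (Fin n × Fin n) →L[ℝ] ℝ) (hess ν)] with θ h
  refine h.trans ?_
  simp

namespace IsSmoothFun

variable {ν : H2 Λ lam P} {f : Sph n → ℝ}

theorem val_ae (h : IsSmoothFun ν f) : (val ν : Sph n → ℝ) =ᵐ[chi lam P] f := by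
  filter_upwards [HarmonicHamiltonian.val_ae ν, h.2] with θ h1 h2
  rw [h1, h2]
  rfl

theorem grad_ae (h : IsSmoothFun ν f) : (grad ν : Sph n → Euc n) =ᵐ[chi lam P] sphGrad f := by
  filter_upwards [HarmonicHamiltonian.grad_ae ν, h.2] with θ h1 h2
  rw [h1, h2]
  rfl

theorem hess_ae (h : IsSmoothFun ν f) :
    (hess ν : Sph n → EuclideanSpace ℝ (Fin n × Fin n)) =ᵐ[chi lam P]
      fun θ => WithLp.toLp 2 fun ij : Fin n × Fin n => sphHess f θ ij.1 ij.2 := by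
  filter_upwards [HarmonicHamiltonian.hess_ae ν, h.2] with θ h1 h2
  rw [h1, h2]
  rfl

theorem lap_ae (h : IsSmoothFun ν f) :
    (lap ν : Sph n → ℝ) =ᵐ[chi lam P] fun θ => (sphHess f θ).trace := by
  filter_upwards [HarmonicHamiltonian.lap_ae ν, h.hess_ae] with θ h1 h2
  rw [h1, h2]
  rfl

end IsSmoothFun

theorem pairing_apply {V : Type} [NormedAddCommGroup V] [InnerProductSpace ℝ V]
    (S T : H2 Λ lam P →L[ℝ] Lp V 2 (chi lam P)) (ν μ : H2 Λ lam P) :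
    pairing S T ν μ = ∫ θ, inner ℝ (S ν θ) (T μ θ) ∂chi lam P := by
  simp [pairing, L2.inner_def]

/-! ### The constant function -/

theorem ext_one_eventuallyEq {x : Euc n} (hx : x ≠ 0) :
    ext (fun _ : Sph n => (1 : ℝ)) =ᶠ[nhds x] fun _ => 1 := by
  filter_upwards [isOpen_ne.mem_nhds hx] with y hy
  exact dif_pos hy

theorem sphere_ne_zero (θ : Sph n) : (θ : Euc n) ≠ 0 := ne_zero_of_mem_unit_sphere θ

theorem smoothOn_one : SmoothOn Λ (fun _ : Sph n => (1 : ℝ)) := by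
  rintro x ⟨r, hr, θ, -, rfl⟩
  have hx : r • (θ : Euc n) ≠ 0 := smul_ne_zero hr.ne' (sphere_ne_zero θ)
  exact (contDiffAt_const.congr_of_eventuallyEq (ext_one_eventuallyEq hx)).contDiffWithinAt

theorem jet_one (θ : Sph n) : jet (fun _ : Sph n => (1 : ℝ)) θ = WithLp.toLp 2 (1, 0) := by
  have h1 := ext_one_eventuallyEq (sphere_ne_zero θ)
  have hg : sphGrad (fun _ : Sph n => (1 : ℝ)) θ = 0 := by
    rw [sphGrad, gradient, h1.fderiv_eq]
    simp
  have hh : hessE (ext fun _ : Sph n => (1 : ℝ)) (θ : Euc n) = 0 := by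
    ext i j
    have h2 : (fun y => fderiv ℝ (ext fun _ : Sph n => (1 : ℝ)) y (EuclideanSpace.single j 1))
        =ᶠ[nhds (θ : Euc n)] fun _ => 0 := by
      filter_upwards [h1.eventuallyEq_nhds] with y hy
      rw [hy.fderiv_eq]
      simp
    simp only [hessE, Matrix.of_apply, Matrix.zero_apply]
    rw [h2.fderiv_eq]
    simp
  have hs : sphHess (fun _ : Sph n => (1 : ℝ)) θ = 0 := by simp [sphHess, hh]
  simp only [jet, hg, hs, Matrix.zero_apply]
  rfl

/-- Finiteness of `dχ` puts the constant jet in `L²`; its non-zero total mass keeps the class from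
being zero. -/
theorem IsLocalization.exists_one (h : IsLocalization Λ lam lam₀) (hP : 0 ≤ P) :
    ∃ one : H2 Λ lam P, IsSmoothFun one (fun _ => 1) ∧ one ≠ 0 := by
  have := h.isFiniteMeasure_chi hP
  let j : Lp (Jet n) 2 (chi lam P) :=
    (memLp_const (WithLp.toLp 2 (1, 0) : Jet n) : MemLp (fun _ : Sph n => _) 2 (chi lam P)).toLp _
  have hj : (j : Sph n → Jet n) =ᵐ[chi lam P] jet fun _ => 1 := by
    filter_upwards [MemLp.coeFn_toLp (memLp_const (WithLp.toLp 2 (1, 0) : Jet n) :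
      MemLp (fun _ : Sph n => _) 2 (chi lam P))] with θ hθ
    rw [jet_one]
    exact hθ
  have hs : IsSmoothFun (⟨j, Submodule.le_topologicalClosure _ (Submodule.subset_span
      ⟨_, smoothOn_one, hj⟩)⟩ : H2 Λ lam P) (fun _ => 1) := ⟨smoothOn_one, hj⟩
  refine ⟨_, hs, fun h0 => ?_⟩
  have h1 := hs.val_ae
  rw [h0, map_zero] at h1
  have : NeZero (chi lam P) := ⟨fun h2 => h.chi_univ_ne_zero hP (by rw [h2]; rfl)⟩
  obtain ⟨θ, h2, h3⟩ := (h1.and (Lp.coeFn_zero ℝ 2 (chi lam P))).exists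
  rw [h2] at h3
  exact one_ne_zero h3

/-! ### Quadratic functional and averages -/

/-- Pairing with the constant 1 is integration, which exhibits the average as a continuous
functional on `H`. -/
theorem average_eq_pairing (one : H2 Λ lam P) (hone : IsSmoothFun one fun _ => 1) (D : ℝ)
    (ν : H2 Λ lam P) : ⨍ θ, (lap ν θ - D * val ν θ) ∂chi lam P =
      ((chi lam P).real univ)⁻¹ • (pairing lap val ν one - D * pairing val val ν one) := by
  have h : ∀ f : Lp ℝ 2 (chi lam P),
      (fun θ => inner ℝ (f θ) (val one θ)) =ᵐ[chi lam P] f := fun f => by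
    filter_upwards [hone.val_ae] with θ h
    simp [h]
  have hi : ∀ f : Lp ℝ 2 (chi lam P), Integrable f (chi lam P) := fun f =>
    (L2.integrable_inner f (val one)).congr (h f)
  rw [average_eq, pairing_apply, pairing_apply, integral_congr_ae (h (lap ν)),
    integral_congr_ae (h (val ν)), integral_sub (hi _) ((hi _).const_mul D), integral_const_mul]

theorem hamOp_apply (ν μ : H2 Λ lam P) : hamOp p P Λ lam α ν μ =
    ((chi lam P).real univ)⁻¹ * (((n : ℝ) - 2) * pairing lap lap ν μ + pairing hess hess ν μ
      + 2 * (coefA n p + 1 + tildeAlpha n p α) * pairing grad grad ν μ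
      - (coefA n p - α) * (((n : ℝ) - 2) * ((n : ℝ) - 2 - coefA n p + α) + 1) * pairing lap val ν μ
      - α * (((n : ℝ) - 2) * ((n : ℝ) - 2 - α) + 1) * pairing val lap ν μ
      + ((n : ℝ) - 1) * tildeAlpha n p α * (tildeAlpha n p α + coefB n p) *
        pairing val val ν μ) :=
  rfl

theorem pairing_self {V : Type} [NormedAddCommGroup V] [InnerProductSpace ℝ V]
    (S : H2 Λ lam P →L[ℝ] Lp V 2 (chi lam P)) (ν : H2 Λ lam P) :
    pairing S S ν ν = ∫ θ, ‖S ν θ‖ ^ 2 ∂chi lam P := by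
  rw [pairing_apply]
  simp only [real_inner_self_eq_norm_sq]

theorem pairing_real (S T : H2 Λ lam P →L[ℝ] Lp ℝ 2 (chi lam P)) (ν μ : H2 Λ lam P) :
    pairing S T ν μ = ∫ θ, T μ θ * S ν θ ∂chi lam P := by
  rw [pairing_apply]
  simp only [RCLike.inner_apply, conj_trivial]

theorem integral_quadratic_expression {X : Type*} [MeasurableSpace X] {m : Measure X}
    {f₁ f₂ f₃ f₄ f₅ : X → ℝ} (h₁ : Integrable f₁ m) (h₂ : Integrable f₂ m) (h₃ : Integrable f₃ m)
    (h₄ : Integrable f₄ m) (h₅ : Integrable f₅ m) (a b c d : ℝ) :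
    ∫ x, (a * f₁ x + f₂ x + b * f₃ x - c * f₄ x + d * f₅ x) ∂m =
      a * (∫ x, f₁ x ∂m) + (∫ x, f₂ x ∂m) + b * (∫ x, f₃ x ∂m) - c * (∫ x, f₄ x ∂m) +
        d * ∫ x, f₅ x ∂m := by
  have k₁ := h₁.const_mul a
  have k₂ := k₁.add h₂
  have k₃ := h₃.const_mul b
  have k₄ := k₂.add k₃
  have k₅ := h₄.const_mul c
  have k₆ := k₄.sub k₅
  have k₇ := h₅.const_mul d
  simp only [← integral_const_mul]
  exact (integral_add k₆ k₇).trans (congrArg₂ _ ((integral_sub k₄ k₅).trans (congrArg₂ _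
    ((integral_add k₂ k₃).trans (congrArg₂ _ (integral_add k₁ h₂) rfl)) rfl)) rfl)

theorem integrable_norm_sq {V : Type} [NormedAddCommGroup V] [InnerProductSpace ℝ V]
    {X : Type*} [MeasurableSpace X] {m : Measure X} (f : Lp V 2 m) :
    Integrable (fun x => ‖f x‖ ^ 2) m :=
  (L2.integrable_inner (𝕜 := ℝ) f f).congr
    (.of_forall fun _ => real_inner_self_eq_norm_sq _)

theorem integrable_mul_of_L2 {X : Type*} [MeasurableSpace X] {m : Measure X} (f g : Lp ℝ 2 m) :
    Integrable (fun x => f x * g x) m :=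
  (L2.integrable_inner (𝕜 := ℝ) g f).congr (.of_forall fun _ => rfl)

/-- On the diagonal the two mixed pairings coincide, and their coefficients add up to `c +
2(n-2)α(a-α)`. -/
theorem quadForm_eq (ν : H2 Λ lam P) : quadForm p P α ν = hamOp p P Λ lam α ν ν := by
  have e : pairing val lap ν ν = ∫ θ, val ν θ * lap ν θ ∂chi lam P := by
    rw [pairing_real]
    exact integral_congr_ae (.of_forall fun _ => mul_comm _ _)
  have e2 : ∀ S : H2 Λ lam P →L[ℝ] Lp ℝ 2 (chi lam P),
      pairing S S ν ν = ∫ θ, S ν θ ^ 2 ∂chi lam P := fun S => by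
    rw [pairing_real]
    simp only [sq]
  have i2 : ∀ f : Lp ℝ 2 (chi lam P), Integrable (fun θ => f θ ^ 2) (chi lam P) := fun f => by
    simpa only [sq] using integrable_mul_of_L2 f f
  rw [hamOp_apply, e, e2 lap, e2 val, pairing_real lap val, pairing_self, pairing_self, quadForm,
    average_eq, smul_eq_mul, integral_quadratic_expression (i2 (lap ν))
      (integrable_norm_sq (hess ν)) (integrable_norm_sq (grad ν))
      (integrable_mul_of_L2 (val ν) (lap ν)) (i2 (val ν))]
  generalize (∫ θ, lap ν θ ^ 2 ∂chi lam P) = x₁, (∫ θ, ‖hess ν θ‖ ^ 2 ∂chi lam P) = x₂,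
    (∫ θ, ‖grad ν θ‖ ^ 2 ∂chi lam P) = x₃, (∫ θ, val ν θ * lap ν θ ∂chi lam P) = x₄,
    (∫ θ, val ν θ ^ 2 ∂chi lam P) = x₅
  simp only [coefC, tildeAlpha]
  ring

theorem jet_one_snd (θ : Sph n) : sphGrad (fun _ : Sph n => (1 : ℝ)) θ = 0 ∧
    sphHess (fun _ : Sph n => (1 : ℝ)) θ = 0 := by
  have h := congrArg (fun x : Jet n => x.snd) (jet_one θ)
  refine ⟨congrArg (fun x => x.fst) h, ?_⟩
  ext i j
  exact congrArg (fun x => x.snd (i, j)) h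

theorem IsSmoothFun.grad_one {one : H2 Λ lam P} (hone : IsSmoothFun one fun _ => 1) :
    grad one = 0 := by
  refine Lp.ext ?_
  filter_upwards [hone.grad_ae, Lp.coeFn_zero (Euc n) 2 (chi lam P)] with θ h1 h2
  rw [h1, h2, (jet_one_snd θ).1]
  rfl

theorem IsSmoothFun.hess_one {one : H2 Λ lam P} (hone : IsSmoothFun one fun _ => 1) :
    hess one = 0 := by
  refine Lp.ext ?_
  filter_upwards [hone.hess_ae, Lp.coeFn_zero (EuclideanSpace ℝ (Fin n × Fin n)) 2 (chi lam P)]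
    with θ h1 h2
  rw [h1, h2, (jet_one_snd θ).2]
  rfl

theorem IsSmoothFun.lap_one {one : H2 Λ lam P} (hone : IsSmoothFun one fun _ => 1) :
    lap one = 0 := by
  rw [lap, ContinuousLinearMap.comp_apply, hone.hess_one, map_zero]

theorem pairing_eq_zero {V : Type} [NormedAddCommGroup V] [InnerProductSpace ℝ V]
    (S T : H2 Λ lam P →L[ℝ] Lp V 2 (chi lam P)) (ν : H2 Λ lam P) {μ : H2 Λ lam P}
    (h : T μ = 0) : pairing S T ν μ = 0 :=
  (congrArg (inner ℝ (S ν)) h).trans (inner_zero_right _)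

/-- The zeros stand for pairings with derivatives of the constant 1. What is left factors because
`D^α` times its denominator is `(n-1)α(α(a-α)+b)`. -/
theorem ham_one_algebra
    (hK : ((n : ℝ) - 2) * ((n : ℝ) - 2 - coefA n p + α) + 1 ≠ 0) (x y z : ℝ) :
    z * (((n : ℝ) - 2) * 0 + 0 + 2 * (coefA n p + 1 + tildeAlpha n p α) * 0
      - (coefA n p - α) * (((n : ℝ) - 2) * ((n : ℝ) - 2 - coefA n p + α) + 1) * x
      - α * (((n : ℝ) - 2) * ((n : ℝ) - 2 - α) + 1) * 0
      + ((n : ℝ) - 1) * tildeAlpha n p α * (tildeAlpha n p α + coefB n p) * y) =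
    -((coefA n p - α) * (((n : ℝ) - 2) * ((n : ℝ) - 2 - coefA n p + α) + 1)) *
      (z • (x - coefDalpha n p α * y)) := by
  have h := div_mul_cancel₀ (((n : ℝ) - 1) * α * (α * (coefA n p - α) + coefB n p)) hK
  rw [smul_eq_mul, tildeAlpha, coefDalpha]
  linear_combination (-(z * y * (coefA n p - α))) * h

theorem hamOp_apply_one (one : H2 Λ lam P) (hone : IsSmoothFun one fun _ => 1)
    (hK : ((n : ℝ) - 2) * ((n : ℝ) - 2 - coefA n p + α) + 1 ≠ 0) (ν : H2 Λ lam P) :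
    hamOp p P Λ lam α ν one =
      -((coefA n p - α) * (((n : ℝ) - 2) * ((n : ℝ) - 2 - coefA n p + α) + 1)) *
        ⨍ θ, (lap ν θ - coefDalpha n p α * val ν θ) ∂chi lam P := by
  rw [average_eq_pairing one hone, hamOp_apply, pairing_eq_zero lap lap ν hone.lap_one,
    pairing_eq_zero val lap ν hone.lap_one, pairing_eq_zero grad grad ν hone.grad_one,
    pairing_eq_zero hess hess ν hone.hess_one]
  exact ham_one_algebra hK _ _ _

/-- The average of `Δν - D ν`, as a continuous functional of `ν`. -/
def averageFunctional (one : H2 Λ lam P) (D : ℝ) : H2 Λ lam P →L[ℝ] ℝ :=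
  ((chi lam P).real univ)⁻¹ • ((pairing lap val).flip one - D • (pairing val val).flip one)

theorem averageFunctional_apply (one : H2 Λ lam P) (hone : IsSmoothFun one fun _ => 1) (D : ℝ)
    (ν : H2 Λ lam P) :
    averageFunctional one D ν = ⨍ θ, (lap ν θ - D * val ν θ) ∂chi lam P := by
  rw [average_eq_pairing one hone, averageFunctional, smul_apply, sub_apply, smul_apply,
    ContinuousLinearMap.flip_apply, ContinuousLinearMap.flip_apply, smul_eq_mul, smul_eq_mul,
    smul_eq_mul]

theorem averageFunctional_one (h : IsLocalization Λ lam lam₀) (hP : 0 ≤ P) (one : H2 Λ lam P)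
    (hone : IsSmoothFun one fun _ => 1) (D : ℝ) : averageFunctional one D one = -D := by
  have := h.isFiniteMeasure_chi hP
  have h0 := (h.chi_real_univ_pos hP).ne'
  have hl : (lap one : Sph n → ℝ) =ᵐ[chi lam P] 0 := by
    rw [hone.lap_one]
    exact Lp.coeFn_zero _ _ _
  rw [averageFunctional_apply one hone]
  have : (fun θ => lap one θ - D * val one θ) =ᵐ[chi lam P] fun _ => -D := by
    filter_upwards [hl, hone.val_ae] with θ h1 h2
    simp [h1, h2]
  rw [average_eq, integral_congr_ae this]
  simp [h0]

theorem coefD_eq : coefD n p = coefDalpha n p (coefA n p) := by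
  simp only [coefD, coefDalpha]
  congr 1 <;> ring

/-! ### Consequences of the stability condition -/

theorem denominator_pos (hn : 3 ≤ n) (hp : 0 < p) (hα : coefA n p / 2 ≤ α) :
    0 < ((n : ℝ) - 2) * ((n : ℝ) - 2 - coefA n p + α) + 1 := by
  have h3 : (3 : ℝ) ≤ n := by exact_mod_cast hn
  have h : 0 < (n : ℝ) - 2 - coefA n p + α := by
    -- The lower bound `a/2` for the exponent is what turns `p > 0` into positivity here.
    have : (n : ℝ) - 2 - coefA n p + coefA n p / 2 = p := by simp only [coefA]; ring
    linarith
  have : 0 < (n : ℝ) - 2 := by linarith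
  positivity

/-- If `D^α` vanished, the constant 1 would satisfy the constraint of the stability condition while
its quadratic functional is zero. -/
theorem coefDalpha_ne_zero (hstab : HarmonicStability p P Λ lam) (hn : 3 ≤ n) (hp : 0 < p)
    (h : IsLocalization Λ lam lam₀) (hP : 0 ≤ P) (hα : α ∈ Icc (coefA n p / 2) (coefA n p)) : coefDalpha n p α ≠ 0 := by
  intro hD
  obtain ⟨one, hone, hne⟩ := h.exists_one hP
  obtain ⟨C, hC, hB⟩ := hstab α hα
  have hK := denominator_pos hn hp hα.1
  have h3 : (3 : ℝ) ≤ n := by exact_mod_cast hn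
  have hav : ⨍ θ, (lap one θ - coefDalpha n p α * val one θ) ∂chi lam P = 0 := by
    rw [← averageFunctional_apply one hone, averageFunctional_one h hP one hone, hD, neg_zero]
  have h1 := hB one hav
  rw [quadForm_eq, hamOp_apply_one one hone hK.ne', hav, mul_zero, mul_zero] at h1
  exact hne (norm_eq_zero.1 (pow_eq_zero_iff two_ne_zero |>.1 (le_antisymm h1 (sq_nonneg _))))

end Space

section Operators

variable {n : ℕ} {Λ : Set (Sph n)} {lam : Sph n → ℝ} {lam₀ P p α : ℝ}

/-- The stability condition is the coercivity of the operator on a hyperplane. -/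
theorem HarmonicStability.coercive (hstab : HarmonicStability p P Λ lam)
    (hα : α ∈ Icc (coefA n p / 2) (coefA n p)) (one : H2 Λ lam P)
    (hone : IsSmoothFun one fun _ => 1) : ∃ C : ℝ, 0 < C ∧ ∀ ν : H2 Λ lam P,
      averageFunctional one (coefDalpha n p α) ν = 0 → ‖ν‖ ^ 2 ≤ C * hamOp p P Λ lam α ν ν := by
  obtain ⟨C, hC, h⟩ := hstab α hα
  refine ⟨C, hC, fun ν hν => ?_⟩
  rw [← quadForm_eq]
  exact h ν ((averageFunctional_apply one hone _ ν).symm.trans hν)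

theorem averageFunctional_one_ne_zero (hstab : HarmonicStability p P Λ lam) (hn : 3 ≤ n)
    (hp : 0 < p) (h : IsLocalization Λ lam lam₀) (hP : 0 ≤ P)
    (hα : α ∈ Icc (coefA n p / 2) (coefA n p)) (one : H2 Λ lam P)
    (hone : IsSmoothFun one fun _ => 1) : averageFunctional one (coefDalpha n p α) one ≠ 0 := by
  rw [averageFunctional_one h hP one hone]
  exact neg_ne_zero.2 (coefDalpha_ne_zero hstab hn hp h hP hα)

theorem hamOp_one_eq (hn : 3 ≤ n) (hp : 0 < p) (hα : coefA n p / 2 ≤ α) (one : H2 Λ lam P)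
    (hone : IsSmoothFun one fun _ => 1) (ν : H2 Λ lam P) :
    hamOp p P Λ lam α ν one =
      -((coefA n p - α) * (((n : ℝ) - 2) * ((n : ℝ) - 2 - coefA n p + α) + 1)) *
        averageFunctional one (coefDalpha n p α) ν := by
  rw [averageFunctional_apply one hone, hamOp_apply_one one hone (denominator_pos hn hp hα).ne']

theorem hamOp_harmonic_one_eq_zero (hn : 3 ≤ n) (hp : p ∈ Ioo (0 : ℝ) ((n : ℝ) - 2))
    (one : H2 Λ lam P) (hone : IsSmoothFun one fun _ => 1) (ν : H2 Λ lam P) :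
    hamOp p P Λ lam (coefA n p) ν one = 0 := by
  have ha : 0 ≤ coefA n p := by have := hp.2; simp only [coefA]; linarith
  rw [hamOp_one_eq hn hp.1 (by linarith) one hone]
  simp

theorem hamOp_bijective (hstab : HarmonicStability p P Λ lam) (hn : 3 ≤ n)
    (hp : 0 < p) (h : IsLocalization Λ lam lam₀) (hP : 0 ≤ P)
    (hα : α ∈ Ico (coefA n p / 2) (coefA n p)) :
    Function.Bijective (hamOp p P Λ lam α) ∧
      (hamOp p P Λ lam α).ker = ⊥ ∧ (hamOp p P Λ lam α).flip.ker = ⊥ := by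
  obtain ⟨one, hone, -⟩ := h.exists_one hP
  have hα' := Ico_subset_Icc_self hα
  obtain ⟨C, hC, hB⟩ := hstab.coercive hα' one hone
  exact bijective_of_coercive_on_ker hC hB
    (averageFunctional_one_ne_zero hstab hn hp h hP hα' one hone)
    (neg_ne_zero.2 (mul_ne_zero (sub_pos.2 hα.2).ne' (denominator_pos hn hp hα.1).ne'))
    (hamOp_one_eq hn hp hα.1 one hone)

theorem zeta_ne_zero (h : IsLocalization Λ lam lam₀) (hP : 0 ≤ P) :
    zeta P lam ≠ 0 := by
  have h1 := h.chi_real_univ_pos hP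
  have hne : Λ.Nonempty := closure_nonempty_iff.1 h.isConnected_closure.nonempty
  have h2 : 0 < (surf n).real univ :=
    ENNReal.toReal_pos (isOpen_univ.measure_ne_zero _ (hne.mono (subset_univ _)))
      (measure_ne_top _ _)
  have : (0 : ℝ) < ((n : ℝ) - 2) ^ 2 + 1 := by positivity
  unfold zeta
  positivity

end Operators

/-! ### Derivatives of functions on the cone in polar coordinates -/

section Polar

variable {n : ℕ} {Λ : Set (Sph n)} {f : Sph n → ℝ}

theorem mem_cone_iff {x : Euc n} (hx : x ≠ 0) :
    x ∈ cone Λ ↔ (⟨‖x‖⁻¹ • x, by simp [norm_smul, norm_ne_zero_iff.mpr hx]⟩ : Sph n) ∈ Λ := by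
  constructor
  · rintro ⟨r, hr, θ, hθ, rfl⟩
    convert hθ
    ext1
    simp [norm_smul, abs_of_pos hr, smul_smul, hr.ne']
  · intro h
    exact ⟨‖x‖, norm_pos_iff.2 hx, _, h, by simp [smul_smul, hx]⟩

theorem ne_zero_of_mem_cone {x : Euc n} (hx : x ∈ cone Λ) : x ≠ 0 := by
  obtain ⟨r, hr, θ, -, rfl⟩ := hx
  exact smul_ne_zero hr.ne' (ne_zero_of_mem_unit_sphere θ)

theorem ext_smul (f : Sph n → ℝ) {r : ℝ} (hr : 0 < r) (x : Euc n) : ext f (r • x) = ext f x := by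
  unfold ext
  by_cases hx : x = 0
  · simp [hx]
  · have h2 : r • x ≠ 0 := smul_ne_zero hr.ne' hx
    rw [dif_pos hx, dif_pos h2]
    congr 2
    rw [norm_smul, Real.norm_of_nonneg hr.le, smul_smul, mul_inv, mul_right_comm,
      inv_mul_cancel₀ hr.ne', one_mul]

theorem ext_coe (f : Sph n → ℝ) (θ : Sph n) : ext f (θ : Euc n) = f θ := by
  unfold ext
  rw [dif_pos (ne_zero_of_mem_unit_sphere θ)]
  congr 1
  ext1
  simp

theorem ext_smul_coe (f : Sph n → ℝ) {r : ℝ} (hr : 0 < r) (θ : Sph n) :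
    ext f (r • (θ : Euc n)) = f θ := by
  rw [ext_smul f hr, ext_coe]

theorem isOpen_cone (hΛ : IsOpen Λ) : IsOpen (cone Λ) := by
  rw [isOpen_iff_mem_nhds]
  intro x hx
  have hx0 := ne_zero_of_mem_cone hx
  -- The cone is the preimage of `Λ` under normalization, which is continuous only away from the
  -- origin.
  let g : ({0}ᶜ : Set (Euc n)) → Sph n := fun y =>
    ⟨‖(y : Euc n)‖⁻¹ • (y : Euc n), by
      have : (y : Euc n) ≠ 0 := y.2
      simp [norm_smul, norm_ne_zero_iff.mpr this]⟩
  have hg : Continuous g := by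
    refine Continuous.subtype_mk (Continuous.smul (Continuous.inv₀ continuous_subtype_val.norm
      fun y => ?_) continuous_subtype_val) _
    exact norm_ne_zero_iff.2 y.2
  have ho : IsOpen ((↑) '' (g ⁻¹' Λ) : Set (Euc n)) :=
    isOpen_compl_singleton.isOpenMap_subtype_val _ (hΛ.preimage hg)
  refine Filter.mem_of_superset (ho.mem_nhds ⟨⟨x, hx0⟩, (mem_cone_iff hx0).1 hx, rfl⟩) ?_
  rintro _ ⟨y, hy, rfl⟩
  exact (mem_cone_iff y.2).2 hy

theorem smul_mem_cone {r : ℝ} (hr : 0 < r) (θ : Sph n) : r • (θ : Euc n) ∈ cone Λ ↔ θ ∈ Λ := by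
  constructor
  · rintro ⟨s, hs, η, hη, h⟩
    have hrs : r = s := by
      have := congrArg norm h
      simpa [norm_smul, abs_of_pos, hr, hs] using this
    subst hrs
    have : θ = η := Subtype.ext (smul_right_injective _ hr.ne' h)
    exact this ▸ hη
  · exact fun h => ⟨r, hr, θ, h, rfl⟩

/-- Homogeneity of degree 0 of `ext f` gives degree -1 for first derivatives and, iterating, -2 for
second ones. No smoothness enters, as dilations are invertible. -/
theorem fderiv_ext_smul (f : Sph n → ℝ) {r : ℝ} (hr : 0 < r) (x : Euc n) :
    fderiv ℝ (ext f) (r • x) = r⁻¹ • fderiv ℝ (ext f) x := by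
  have h := fderiv_comp_smul (f := ext f) (x := x) r
  simp only [ext_smul f hr] at h
  rw [h, smul_smul, inv_mul_cancel₀ hr.ne', one_smul]

theorem hessE_ext_smul (f : Sph n → ℝ) {r : ℝ} (hr : 0 < r) (x : Euc n) :
    hessE (ext f) (r • x) = (r ^ 2)⁻¹ • hessE (ext f) x := by
  ext i j
  simp only [hessE, Matrix.of_apply, Matrix.smul_apply]
  have h := fderiv_comp_smul (f := fun y => fderiv ℝ (ext f) y (EuclideanSpace.single j 1))
    (x := x) r
  have h2 : (fun y : Euc n => fderiv ℝ (ext f) (r • y) (EuclideanSpace.single j 1)) =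
      fun y => r⁻¹ • fderiv ℝ (ext f) y (EuclideanSpace.single j 1) := by
    ext y
    rw [fderiv_ext_smul f hr]
    rfl
  rw [h2] at h
  have h4 := congrFun (fderiv_const_smul_field (𝕜 := ℝ)
    (f := fun y => fderiv ℝ (ext f) y (EuclideanSpace.single j 1)) r⁻¹) x
  rw [show fderiv ℝ (fun y => r⁻¹ • fderiv ℝ (ext f) y (EuclideanSpace.single j 1)) x = _ from h4]
    at h
  have h3 := congrArg (fun T => r⁻¹ • T (EuclideanSpace.single i 1)) h
  simp only [smul_apply, smul_smul, inv_mul_cancel₀ hr.ne', one_smul] at h3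
  rw [← h3, sq, mul_inv, Pi.smul_apply, smul_apply, smul_smul]

theorem SmoothOn.contDiffAt (hf : SmoothOn Λ f) (hΛ : IsOpen Λ) {x : Euc n} (hx : x ∈ cone Λ) :
    ContDiffAt ℝ ∞ (ext f) x :=
  (hf x hx).contDiffAt ((isOpen_cone hΛ).mem_nhds hx)

theorem SmoothOn.contDiffAt_fderiv (hf : SmoothOn Λ f) (hΛ : IsOpen Λ) {x : Euc n}
    (hx : x ∈ cone Λ) (v : Euc n) : ContDiffAt ℝ ∞ (fun y => fderiv ℝ (ext f) y v) x :=
  ((hf.contDiffAt hΛ hx).fderiv_right (m := ∞) (by simp)).clm_apply contDiffAt_const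

end Polar

/-! ### Derivatives of radial multiples of a function -/

section Radial

variable {E : Type*} [NormedAddCommGroup E] [InnerProductSpace ℝ E]

theorem hasFDerivAt_norm_of_ne_zero {x : E} (hx : x ≠ 0) :
    HasFDerivAt (fun y : E => ‖y‖) (‖x‖⁻¹ • innerSL ℝ x) x := by
  have h := (hasStrictFDerivAt_norm_sq x).hasFDerivAt.sqrt (by simpa using hx)
  simp only [Real.sqrt_sq (norm_nonneg _)] at h
  refine h.congr_fderiv ?_
  ext v
  have : ‖x‖ ≠ 0 := norm_ne_zero_iff.2 hx
  simp
  field_simp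

theorem hasFDerivAt_radial {φ : ℝ → ℝ} {φ' : ℝ} {x : E} (hx : x ≠ 0)
    (hφ : HasDerivAt φ φ' ‖x‖) :
    HasFDerivAt (fun y : E => φ ‖y‖) (φ' • ‖x‖⁻¹ • innerSL ℝ x) x :=
  hφ.comp_hasFDerivAt x (hasFDerivAt_norm_of_ne_zero hx)

theorem fderiv_radial_mul {φ φ₁ : ℝ → ℝ} {F : E → ℝ} {x : E} (hx : x ≠ 0)
    (hφ : HasDerivAt φ (φ₁ ‖x‖) ‖x‖) (hF : DifferentiableAt ℝ F x) (v : E) :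
    fderiv ℝ (fun y => φ ‖y‖ * F y) x v =
      φ₁ ‖x‖ * ‖x‖⁻¹ * inner ℝ v x * F x + φ ‖x‖ * fderiv ℝ F x v := by
  rw [((hasFDerivAt_radial hx hφ).fun_mul hF.hasFDerivAt).fderiv]
  simp [real_inner_comm]
  ring

/-- The second derivatives of a function multiplied by a radial function. -/
theorem fderiv_fderiv_radial_mul {φ φ₁ : ℝ → ℝ} {φ₂ : ℝ} {F : E → ℝ} {x : E} (hx : x ≠ 0)
    (hφ : ∀ r, 0 < r → HasDerivAt φ (φ₁ r) r) (hφ₁ : HasDerivAt φ₁ φ₂ ‖x‖)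
    (hF : ∀ᶠ y in nhds x, DifferentiableAt ℝ F y) (v w : E)
    (hF₂ : DifferentiableAt ℝ (fun y => fderiv ℝ F y v) x) :
    fderiv ℝ (fun y => fderiv ℝ (fun z => φ ‖z‖ * F z) y v) x w =
      φ₂ * ‖x‖⁻¹ ^ 2 * inner ℝ v x * inner ℝ w x * F x +
      φ₁ ‖x‖ * ‖x‖⁻¹ * (inner ℝ v w - ‖x‖⁻¹ ^ 2 * inner ℝ v x * inner ℝ w x) * F x +
      φ₁ ‖x‖ * ‖x‖⁻¹ * (inner ℝ v x * fderiv ℝ F x w + inner ℝ w x * fderiv ℝ F x v) +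
      φ ‖x‖ * fderiv ℝ (fun y => fderiv ℝ F y v) x w := by
  have hx0 : 0 < ‖x‖ := norm_pos_iff.2 hx
  -- Differentiating again requires the first-order formula on a whole neighbourhood, not only at
  -- `x`.
  have he : (fun y => fderiv ℝ (fun z => φ ‖z‖ * F z) y v) =ᶠ[nhds x] fun y =>
      φ₁ ‖y‖ * ‖y‖⁻¹ * inner ℝ v y * F y + φ ‖y‖ * fderiv ℝ F y v := by
    filter_upwards [hF, isOpen_ne.mem_nhds hx] with y hy hy0
    exact fderiv_radial_mul hy0 (hφ _ (norm_pos_iff.2 hy0)) hy v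
  have h1 := hasFDerivAt_radial hx hφ₁
  have h2 := hasFDerivAt_radial hx (hasDerivAt_inv hx0.ne')
  have h3 : HasFDerivAt (fun y : E => inner ℝ v y) (innerSL ℝ v) x := (innerSL ℝ v).hasFDerivAt
  have h4 := hasFDerivAt_radial hx (hφ _ hx0)
  rw [he.fderiv_eq, ((((h1.fun_mul h2).fun_mul h3).fun_mul hF.self_of_nhds.hasFDerivAt).fun_add
    (h4.fun_mul hF₂.hasFDerivAt)).fderiv]
  simp [real_inner_comm]
  field_simp
  ring

end Radial

/-! ### The Euclidean Hessian at a point of a ray -/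

section Polar

variable {n : ℕ} {Λ : Set (Sph n)} {f : Sph n → ℝ}

theorem norm_smul_coe {r : ℝ} (hr : 0 < r) (θ : Sph n) : ‖r • (θ : Euc n)‖ = r := by
  simp [norm_smul, abs_of_pos hr]

theorem sphGrad_apply (f : Sph n → ℝ) (θ : Sph n) (i : Fin n) :
    sphGrad f θ i = fderiv ℝ (ext f) θ (EuclideanSpace.single i 1) := by
  rw [← inner_gradient_left, ← sphGrad]
  simp [EuclideanSpace.inner_single_right]

/-- The Euclidean Hessian in polar coordinates. -/
theorem hessE_radial_mul (hΛ : IsOpen Λ) (hf : SmoothOn Λ f) {θ : Sph n} (hθ : θ ∈ Λ) {r : ℝ}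
    (hr : 0 < r) {φ φ₁ : ℝ → ℝ} {φ₂ : ℝ} (hφ : ∀ s, 0 < s → HasDerivAt φ (φ₁ s) s)
    (hφ₁ : HasDerivAt φ₁ φ₂ r) (i j : Fin n) :
    hessE (fun x => φ ‖x‖ * ext f x) (r • (θ : Euc n)) i j =
      φ₂ * f θ * ((θ : Euc n) i * (θ : Euc n) j) +
      φ₁ r / r * f θ * ((1 : Matrix (Fin n) (Fin n) ℝ) i j - (θ : Euc n) i * (θ : Euc n) j) +
      φ₁ r / r * ((θ : Euc n) j * sphGrad f θ i + (θ : Euc n) i * sphGrad f θ j) +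
      φ r / r ^ 2 * hessE (ext f) θ i j := by
  have hx := (smul_mem_cone (Λ := Λ) hr θ).2 hθ
  have h := fderiv_fderiv_radial_mul (F := ext f) (ne_zero_of_mem_cone hx) hφ
    (by rwa [norm_smul_coe hr])
    (by
      filter_upwards [(isOpen_cone hΛ).mem_nhds hx] with y hy
      exact (hf.contDiffAt hΛ hy).differentiableAt (by simp))
    (EuclideanSpace.single j 1) (EuclideanSpace.single i 1)
    ((hf.contDiffAt_fderiv hΛ hx _).differentiableAt (by simp))
  have h2 := congrFun (congrFun (hessE_ext_smul f hr (θ : Euc n)) i) j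
  have h3 : ∀ k, inner ℝ (EuclideanSpace.single k (1 : ℝ)) (r • (θ : Euc n)) =
      r * (θ : Euc n) k := fun k => by simp [EuclideanSpace.inner_single_left]
  have h4 : inner ℝ (EuclideanSpace.single j (1 : ℝ)) (EuclideanSpace.single i (1 : ℝ)) =
      (1 : Matrix (Fin n) (Fin n) ℝ) i j := by
    simp [EuclideanSpace.inner_single_left, Matrix.one_apply, eq_comm]
  simp only [hessE, Matrix.of_apply, Matrix.smul_apply] at h2 ⊢
  rw [h, norm_smul_coe hr, ext_smul_coe f hr, fderiv_ext_smul f hr, h2, sphGrad_apply,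
    sphGrad_apply, h3, h3, h4, smul_apply, smul_apply, smul_eq_mul, smul_eq_mul, smul_eq_mul]
  generalize (1 : Matrix (Fin n) (Fin n) ℝ) i j = a₁, (θ : Euc n) i = a₂, (θ : Euc n) j = a₃,
    f θ = a₄, fderiv ℝ (ext f) θ (EuclideanSpace.single i 1) = a₅,
    fderiv ℝ (ext f) θ (EuclideanSpace.single j 1) = a₆, φ r = a₇, φ₁ r = a₈
  generalize fderiv ℝ (fun y => fderiv ℝ (ext f) y (EuclideanSpace.single j 1)) θ
    (EuclideanSpace.single i 1) = a₉
  field_simp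

end Polar

/-! ### Euler identities and the covariant Hessian -/

section SphereHessian

variable {n : ℕ} {Λ : Set (Sph n)} {f : Sph n → ℝ}

theorem sum_sq_sphere (θ : Sph n) : ∑ i, (θ : Euc n) i * (θ : Euc n) i = 1 := by
  have h : ‖(θ : Euc n)‖ = 1 := by simp
  have h2 := EuclideanSpace.real_norm_sq_eq (θ : Euc n)
  rw [h, one_pow] at h2
  simp only [← sq, h2]

theorem euc_eq_sum_single (x : Euc n) : x = ∑ i, x i • EuclideanSpace.single i (1 : ℝ) := by
  ext k
  simp [Finset.sum_apply, Pi.single_apply]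

theorem fderiv_apply_eq_sum (T : Euc n →L[ℝ] ℝ) (x : Euc n) :
    T x = ∑ i, x i * T (EuclideanSpace.single i 1) := by
  conv_lhs => rw [euc_eq_sum_single x]
  simp

/-- Euler's identity at a point of the sphere, for a function whose restriction to the ray through
this point is a power. -/
theorem fderiv_apply_self_of_homogeneous {G : Euc n → ℝ} {θ : Euc n} {k : ℝ}
    (hG : DifferentiableAt ℝ G θ) (h : ∀ r : ℝ, 0 < r → G (r • θ) = r ^ k * G θ) :
    fderiv ℝ G θ θ = k * G θ := by
  have h0 : HasDerivAt (fun r : ℝ => r • θ) θ 1 := by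
    simpa using (hasDerivAt_id (1 : ℝ)).smul_const θ
  have hG' : HasFDerivAt G (fderiv ℝ G θ) ((1 : ℝ) • θ) := by
    rw [one_smul]; exact hG.hasFDerivAt
  have h1 : HasDerivAt (fun r : ℝ => G (r • θ)) (fderiv ℝ G θ θ) 1 :=
    hG'.comp_hasDerivAt (1 : ℝ) h0
  have h2 : HasDerivAt (fun r : ℝ => r ^ k * G θ) (k * G θ) 1 := by
    simpa using (Real.hasDerivAt_rpow_const (x := 1) (p := k) (Or.inl one_ne_zero)).mul_const (G θ)
  refine h1.unique (h2.congr_of_eventuallyEq ?_)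
  filter_upwards [Ioi_mem_nhds (one_pos (α := ℝ))] with r hr
  exact h r hr

section AtPoint

variable {θ : Sph n}

theorem coe_mem_cone (hθ : θ ∈ Λ) : (θ : Euc n) ∈ cone Λ := ⟨1, one_pos, θ, hθ, by simp⟩

theorem sphGrad_dot_self (hΛ : IsOpen Λ) (hf : SmoothOn Λ f) (hθ : θ ∈ Λ) :
    (fun i => (θ : Euc n) i) ⬝ᵥ (fun i => sphGrad f θ i) = 0 := by
  have h := fderiv_apply_self_of_homogeneous (k := 0)
    ((hf.contDiffAt hΛ (coe_mem_cone hθ)).differentiableAt (by simp))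
    (fun r hr => by rw [ext_smul f hr]; simp)
  rw [fderiv_apply_eq_sum, zero_mul] at h
  simpa only [dotProduct, sphGrad_apply] using h

/-- Euler's identity for the partial derivatives, homogeneous of degree -1. The mixed
radial–tangential part of the Hessian of the extension is therefore minus the gradient. -/
theorem vecMul_hessE_ext (hΛ : IsOpen Λ) (hf : SmoothOn Λ f) (hθ : θ ∈ Λ) :
    Matrix.vecMul (fun i => (θ : Euc n) i) (hessE (ext f) (θ : Euc n)) =
      -fun i => sphGrad f θ i := by
  ext j
  have h := fderiv_apply_self_of_homogeneous (k := -1)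
    ((hf.contDiffAt_fderiv hΛ (coe_mem_cone hθ) (EuclideanSpace.single j 1)).differentiableAt
      (by simp))
    (fun r hr => by rw [fderiv_ext_smul f hr, Real.rpow_neg_one]; rfl)
  rw [fderiv_apply_eq_sum] at h
  simpa only [Matrix.vecMul, dotProduct, hessE, Matrix.of_apply, Pi.neg_apply, sphGrad_apply,
    neg_one_mul] using h

theorem hessE_ext_transpose (hΛ : IsOpen Λ) (hf : SmoothOn Λ f) (hθ : θ ∈ Λ) :
    (hessE (ext f) (θ : Euc n)).transpose = hessE (ext f) (θ : Euc n) := by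
  have hc := hf.contDiffAt hΛ (coe_mem_cone hθ)
  have hd : DifferentiableAt ℝ (fderiv ℝ (ext f)) (θ : Euc n) :=
    (hc.fderiv_right (m := 1) (by norm_cast)).differentiableAt (by simp)
  have hs : IsSymmSndFDerivAt ℝ (ext f) (θ : Euc n) := hc.isSymmSndFDerivAt (by simp; norm_cast)
  have he : ∀ v w : Euc n, fderiv ℝ (fun y => fderiv ℝ (ext f) y v) (θ : Euc n) w =
      fderiv ℝ (fderiv ℝ (ext f)) (θ : Euc n) w v := fun v w => by
    rw [(hd.hasFDerivAt.clm_apply (hasFDerivAt_const v _)).fderiv]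
    simp
  ext i j
  simp only [hessE, Matrix.transpose_apply, Matrix.of_apply]
  rw [he, he]
  exact hs _ _

theorem mulVec_hessE_ext (hΛ : IsOpen Λ) (hf : SmoothOn Λ f) (hθ : θ ∈ Λ) :
    Matrix.mulVec (hessE (ext f) (θ : Euc n)) (fun i => (θ : Euc n) i) =
      -fun i => sphGrad f θ i := by
  rw [← hessE_ext_transpose hΛ hf hθ, Matrix.mulVec_transpose, vecMul_hessE_ext hΛ hf hθ]

theorem sphere_dot_self (θ : Sph n) : (fun i => (θ : Euc n) i) ⬝ᵥ (fun i => (θ : Euc n) i) = 1 :=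
  sum_sq_sphere θ

/-- The covariant Hessian differs from the Euclidean Hessian of the extension by the mixed
components. -/
theorem sphHess_eq (hΛ : IsOpen Λ) (hf : SmoothOn Λ f) (hθ : θ ∈ Λ) :
    sphHess f θ = hessE (ext f) (θ : Euc n) +
      Matrix.vecMulVec (fun i => (θ : Euc n) i) (fun i => sphGrad f θ i) +
      Matrix.vecMulVec (fun i => sphGrad f θ i) (fun i => (θ : Euc n) i) := by
  have h1 := sphGrad_dot_self hΛ hf hθ
  rw [dotProduct_comm] at h1
  -- Projecting on both sides also produces a purely radial term, which drops out because the
  -- gradient is orthogonal to `θ`.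
  simp only [sphHess, tangentProj, sub_mul, mul_sub, one_mul, mul_one, Matrix.vecMulVec_mul,
    Matrix.mul_vecMulVec, vecMul_hessE_ext hΛ hf hθ, mulVec_hessE_ext hΛ hf hθ,
    Matrix.vecMulVec_neg, Matrix.neg_vecMulVec, Matrix.neg_mulVec, Matrix.vecMulVec_mulVec, h1,
    MulOpposite.op_zero, zero_smul, neg_zero, Matrix.zero_vecMulVec]
  abel

theorem sphHess_mulVec (θ : Sph n) (f : Sph n → ℝ) :
    Matrix.mulVec (sphHess f θ) (fun i => (θ : Euc n) i) = 0 := by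
  have : Matrix.mulVec (tangentProj θ) (fun i => (θ : Euc n) i) = 0 := by
    rw [tangentProj, Matrix.sub_mulVec, Matrix.vecMulVec_mulVec, sphere_dot_self]
    simp
  rw [sphHess, ← Matrix.mulVec_mulVec, this, Matrix.mulVec_zero]

theorem vecMul_sphHess (θ : Sph n) (f : Sph n → ℝ) :
    Matrix.vecMul (fun i => (θ : Euc n) i) (sphHess f θ) = 0 := by
  have : Matrix.vecMul (fun i => (θ : Euc n) i) (tangentProj θ) = 0 := by
    rw [tangentProj, Matrix.vecMul_sub, Matrix.vecMul_vecMulVec, sphere_dot_self]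
    simp
  rw [sphHess, mul_assoc, ← Matrix.vecMul_vecMul, this, Matrix.zero_vecMul]

end AtPoint

end SphereHessian

/-! ### The Frobenius product of matrices -/

section Frobenius

open Matrix

variable {n : ℕ}

/-- The Frobenius product. -/
def frob (A B : Matrix (Fin n) (Fin n) ℝ) : ℝ := ∑ i, ∑ j, A i j * B i j

theorem frob_comm (A B : Matrix (Fin n) (Fin n) ℝ) : frob A B = frob B A := by
  simp only [frob, mul_comm]

theorem frob_add_left (A B C : Matrix (Fin n) (Fin n) ℝ) :
    frob (A + B) C = frob A C + frob B C := by
  simp only [frob, Matrix.add_apply, add_mul, Finset.sum_add_distrib]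

theorem frob_sub_left (A B C : Matrix (Fin n) (Fin n) ℝ) :
    frob (A - B) C = frob A C - frob B C := by
  simp only [frob, Matrix.sub_apply, sub_mul, Finset.sum_sub_distrib]

theorem frob_smul_left (c : ℝ) (A C : Matrix (Fin n) (Fin n) ℝ) :
    frob (c • A) C = c * frob A C := by
  simp only [frob, Matrix.smul_apply, smul_eq_mul, mul_assoc, Finset.mul_sum]

theorem frob_add_right (A B C : Matrix (Fin n) (Fin n) ℝ) :
    frob C (A + B) = frob C A + frob C B := by
  rw [frob_comm, frob_add_left, frob_comm A, frob_comm B]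

theorem frob_sub_right (A B C : Matrix (Fin n) (Fin n) ℝ) :
    frob C (A - B) = frob C A - frob C B := by
  rw [frob_comm, frob_sub_left, frob_comm A, frob_comm B]

theorem frob_smul_right (c : ℝ) (A C : Matrix (Fin n) (Fin n) ℝ) :
    frob C (c • A) = c * frob C A := by
  rw [frob_comm, frob_smul_left, frob_comm]

theorem frob_one_left (A : Matrix (Fin n) (Fin n) ℝ) : frob 1 A = A.trace := by
  simp [frob, Matrix.one_apply, Matrix.trace]

theorem frob_one_right (A : Matrix (Fin n) (Fin n) ℝ) : frob A 1 = A.trace := by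
  rw [frob_comm, frob_one_left]

theorem frob_vecMulVec_left (a b : Fin n → ℝ) (A : Matrix (Fin n) (Fin n) ℝ) :
    frob (vecMulVec a b) A = a ⬝ᵥ (A *ᵥ b) := by
  simp only [frob, vecMulVec_apply, dotProduct, mulVec, Finset.mul_sum]
  exact Finset.sum_congr rfl fun i _ => Finset.sum_congr rfl fun j _ => by ring

theorem frob_vecMulVec_right (a b : Fin n → ℝ) (A : Matrix (Fin n) (Fin n) ℝ) :
    frob A (vecMulVec a b) = a ⬝ᵥ (A *ᵥ b) := by
  rw [frob_comm, frob_vecMulVec_left]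

/-- The product of the adjoint linearized Hamiltonian operators in terms of the Hessians. -/
theorem frob_sub_trace (A B : Matrix (Fin n) (Fin n) ℝ) :
    frob (A - A.trace • 1) (B - B.trace • 1) = frob A B + ((n : ℝ) - 2) * (A.trace * B.trace) := by
  simp only [frob_sub_left, frob_sub_right, frob_smul_left, frob_smul_right, frob_one_left,
    frob_one_right, trace_sub, trace_smul, trace_one, Fintype.card_fin, smul_eq_mul]
  ring

/-- A symmetric matrix, decomposed along a unit vector and its orthogonal. -/
def polarMatrix (θ g : Fin n → ℝ) (S : Matrix (Fin n) (Fin n) ℝ) (a b c s : ℝ) :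
    Matrix (Fin n) (Fin n) ℝ :=
  (a - b) • vecMulVec θ θ + b • 1 + c • (vecMulVec θ g + vecMulVec g θ) + s • S

theorem trace_polarMatrix {θ g : Fin n → ℝ} (S : Matrix (Fin n) (Fin n) ℝ) (a b c s : ℝ)
    (hθ : θ ⬝ᵥ θ = 1) (hg : θ ⬝ᵥ g = 0) :
    (polarMatrix θ g S a b c s).trace = a + ((n : ℝ) - 1) * b + s * S.trace := by
  simp only [polarMatrix, trace_add, trace_smul, trace_vecMulVec, trace_one, Fintype.card_fin,
    dotProduct_comm g θ, hθ, hg, smul_eq_mul]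
  ring

/-- The radial, mixed and tangential blocks are mutually orthogonal. The tangent projection has
trace `n - 1`, and a mixed block counts twice by symmetry. -/
theorem frob_polarMatrix {θ g k : Fin n → ℝ} {S T : Matrix (Fin n) (Fin n) ℝ}
    (a b c s a' b' c' t : ℝ) (hθ : θ ⬝ᵥ θ = 1) (hg : θ ⬝ᵥ g = 0) (hk : θ ⬝ᵥ k = 0)
    (hS : S *ᵥ θ = 0) (hS' : θ ᵥ* S = 0) (hT : T *ᵥ θ = 0) (hT' : θ ᵥ* T = 0) :
    frob (polarMatrix θ g S a b c s) (polarMatrix θ k T a' b' c' t) =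
      a * a' + ((n : ℝ) - 1) * (b * b') + b * t * T.trace + s * b' * S.trace +
        2 * (c * c') * (g ⬝ᵥ k) + s * t * frob S T := by
  have hS2 : ∀ v, θ ⬝ᵥ (S *ᵥ v) = 0 := fun v => by rw [dotProduct_mulVec, hS', zero_dotProduct]
  have hT2 : ∀ v, θ ⬝ᵥ (T *ᵥ v) = 0 := fun v => by rw [dotProduct_mulVec, hT', zero_dotProduct]
  have hg' : g ⬝ᵥ θ = 0 := by rw [dotProduct_comm, hg]
  have hk' : k ⬝ᵥ θ = 0 := by rw [dotProduct_comm, hk]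
  simp only [polarMatrix, frob_add_left, frob_add_right, frob_smul_left, frob_smul_right,
    frob_one_left, frob_one_right, frob_vecMulVec_left, frob_vecMulVec_right, hS, hT, hS2, hT2,
    trace_one, trace_vecMulVec, one_mulVec, vecMulVec_mulVec, dotProduct_zero, hθ, hg, hk, hg', hk',
    dotProduct_comm k g, Fintype.card_fin, dotProduct_smul, trace_add, trace_smul, add_mulVec,
    smul_mulVec, dotProduct_add, smul_eq_mul, MulOpposite.smul_eq_mul_unop, MulOpposite.unop_op]
  ring

end Frobenius

/-! ### The Hamiltonian operators in polar coordinates -/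

section Pointwise

variable {n : ℕ} {Λ : Set (Sph n)} {f g : Sph n → ℝ} {θ : Sph n} {r : ℝ}

/-- The term `- φ r / r ^ 2` in the mixed coefficient comes from the mixed part of the Hessian of
`ext f`, which the covariant Hessian omits. -/
theorem hessE_radial_mul_eq_polarMatrix (hΛ : IsOpen Λ) (hf : SmoothOn Λ f) (hθ : θ ∈ Λ)
    (hr : 0 < r) {φ φ₁ : ℝ → ℝ} {φ₂ : ℝ} (hφ : ∀ s, 0 < s → HasDerivAt φ (φ₁ s) s)
    (hφ₁ : HasDerivAt φ₁ φ₂ r) :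
    hessE (fun x => φ ‖x‖ * ext f x) (r • (θ : Euc n)) =
      polarMatrix (fun i => (θ : Euc n) i) (fun i => sphGrad f θ i) (sphHess f θ)
        (φ₂ * f θ) (φ₁ r / r * f θ) (φ₁ r / r - φ r / r ^ 2) (φ r / r ^ 2) := by
  ext i j
  rw [hessE_radial_mul hΛ hf hθ hr hφ hφ₁, sphHess_eq hΛ hf hθ]
  simp only [polarMatrix, Matrix.add_apply, Matrix.smul_apply, Matrix.vecMulVec_apply, smul_eq_mul]
  ring

/-- The basic bilinear expressions in two functions and their first two derivatives: the products
of values, of the Laplacian and the value, of the value and the Laplacian, of Laplacians, of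
gradients and of Hessians. -/
def sphProducts (f g : Sph n → ℝ) (θ : Sph n) : Fin 6 → ℝ :=
  ![f θ * g θ, (sphHess f θ).trace * g θ, f θ * (sphHess g θ).trace,
    (sphHess f θ).trace * (sphHess g θ).trace,
    (fun i => sphGrad f θ i) ⬝ᵥ (fun i => sphGrad g θ i), frob (sphHess f θ) (sphHess g θ)]

/-- The coefficients of the product of the operators `dHstar` in polar coordinates. -/
def polarCoef (m α : ℝ) : Fin 3 → Fin 6 → ℝ :=
  ![![α * (α + 1) + (m - 2) * (α * (α + 2 - m)), m - 2, 0, 0, 0, 0],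
    ![-α * (m - 1) + (m - 2) * (m - 1) * (α * (α + 2 - m)), 1 + (m - 2) * (m - 1), 0, 0,
      -2 * (α + 1), 0],
    ![0, 0, -α + (m - 2) * (α * (α + 2 - m)), m - 2, 2 * (α + 1), 1]]

/-- The radial factors in the product of the operators `dHstar`. -/
def radialFactor (α : ℝ) (ψ : ℝ → ℝ) (r : ℝ) : Fin 3 → ℝ :=
  ![deriv (deriv ψ) r * r ^ (-α - 2), deriv ψ r * r ^ (-α - 3), ψ r * r ^ (-α - 4)]

theorem sum_dHstar_mul_dHstar (hΛ : IsOpen Λ) (hf : SmoothOn Λ f) (hg : SmoothOn Λ g) (hθ : θ ∈ Λ)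
    (hr : 0 < r) (α : ℝ) {ψ : ℝ → ℝ} (hψ : ContDiff ℝ ∞ ψ) :
    ∑ i, ∑ j, dHstar (fun x => ‖x‖ ^ (-α) * ext f x) (r • (θ : Euc n)) i j *
        dHstar (fun x => ψ ‖x‖ * ext g x) (r • (θ : Euc n)) i j =
      ∑ k, ∑ j, polarCoef n α k j * (radialFactor α ψ r k * sphProducts f g θ j) := by
  have hp1 : r ^ (-α) / r ^ 2 = r ^ (-α - 2) := by
    rw [Real.rpow_sub hr, Real.rpow_ofNat]
  have hp3 : r ^ (-α - 3) = r ^ (-α - 2) / r := by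
    rw [show -α - 3 = -α - 2 - 1 by ring, Real.rpow_sub_one hr.ne']
  have hp4 : r ^ (-α - 4) = r ^ (-α - 2) / r ^ 2 := by
    rw [show -α - 4 = -α - 2 - 2 by ring, Real.rpow_sub hr, Real.rpow_ofNat]
  have hp2 : -α * r ^ (-α - 1) / r = -α * r ^ (-α - 2) := by
    rw [show -α - 2 = -α - 1 - 1 by ring, Real.rpow_sub_one hr.ne' (-α - 1)]
    ring
  have h1 := hessE_radial_mul_eq_polarMatrix (φ := fun s => s ^ (-α))
    (φ₁ := fun s => -α * s ^ (-α - 1)) (φ₂ := -α * ((-α - 1) * r ^ (-α - 2))) hΛ hf hθ hr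
    (fun s hs => Real.hasDerivAt_rpow_const (Or.inl hs.ne'))
    (by
      have := (Real.hasDerivAt_rpow_const (x := r) (p := -α - 1) (Or.inl hr.ne')).const_mul (-α)
      rwa [show -α - 1 - 1 = -α - 2 by ring] at this)
  have hψ' : ContDiff ℝ ∞ (deriv ψ) := hψ.iterate_deriv 1
  have h2 := hessE_radial_mul_eq_polarMatrix (φ := ψ) (φ₁ := deriv ψ) (φ₂ := deriv (deriv ψ) r)
    hΛ hg hθ hr (fun s _ => (hψ.differentiable (by simp) s).hasDerivAt)
    (hψ'.differentiable (by simp) r).hasDerivAt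
  have hθ1 := sphere_dot_self θ
  have hgf := sphGrad_dot_self hΛ hf hθ
  have hgg := sphGrad_dot_self hΛ hg hθ
  simp only [hp1, hp2] at h1
  change frob (dHstar _ _) (dHstar _ _) = _
  rw [dHstar, dHstar, frob_sub_trace, h1, h2, trace_polarMatrix _ _ _ _ _ hθ1 hgf,
    trace_polarMatrix _ _ _ _ _ hθ1 hgg,
    frob_polarMatrix _ _ _ _ _ _ _ _ hθ1 hgf hgg (sphHess_mulVec θ f) (vecMul_sphHess θ f)
      (sphHess_mulVec θ g) (vecMul_sphHess θ g)]
  -- In the table, `α(α+2-n)` is the coefficient in the Laplacian of `r ^ (-α)`; the factor `n - 2`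
  -- marks the trace contribution.
  simp only [Fin.sum_univ_three, Fin.sum_univ_six, polarCoef, radialFactor, sphProducts,
    Matrix.cons_val, hp3, hp4]
  generalize (sphHess f θ).trace = x₁, (sphHess g θ).trace = x₂, f θ = x₃, g θ = x₄,
    frob (sphHess f θ) (sphHess g θ) = x₅, r ^ (-α - 2) = x₆, ψ r = x₇, deriv ψ r = x₈,
    deriv (deriv ψ) r = x₉, ((fun i => sphGrad f θ i) ⬝ᵥ fun i => sphGrad g θ i) = x₁₀
  ring

end Pointwise

/-! ### Integration over the cone -/

section Integration

theorem integrable_volumeIoiPow {m : ℕ} {h : ℝ → ℝ}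
    (hh : IntegrableOn (fun r => h r * r ^ m) (Ioi 0)) :
    Integrable (fun r : Ioi (0 : ℝ) => h r) (.volumeIoiPow m) := by
  rw [integrableOn_iff_comap_subtypeVal measurableSet_Ioi] at hh
  rw [Measure.volumeIoiPow, integrable_withDensity_iff_integrable_smul' (by fun_prop) (by simp)]
  refine hh.congr (.of_forall fun r => ?_)
  have : 0 ≤ (r : ℝ) ^ m := pow_nonneg (mem_Ioi.1 r.2).le _
  simp [ENNReal.toReal_ofReal this, mul_comm]

theorem integral_volumeIoiPow (m : ℕ) (h : ℝ → ℝ) :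
    ∫ r : Ioi (0 : ℝ), h r ∂.volumeIoiPow m = ∫ r in Ioi (0 : ℝ), h r * r ^ m := by
  rw [← integral_subtype_comap measurableSet_Ioi (fun r => h r * r ^ m), Measure.volumeIoiPow,
    integral_withDensity_eq_integral_toReal_smul (by fun_prop) (by simp)]
  refine integral_congr_ae (.of_forall fun r => ?_)
  have : 0 ≤ (r : ℝ) ^ m := pow_nonneg (mem_Ioi.1 r.2).le _
  simp [ENNReal.toReal_ofReal this, mul_comm]

variable {n : ℕ} {Λ : Set (Sph n)} {lam : Sph n → ℝ} {lam₀ p P R : ℝ}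

/-- Integration in polar coordinates. -/
theorem integral_polar (hn : 0 < n) (F : Euc n → ℝ) :
    ∫ x, F x = ∫ z : Sph n × Ioi (0 : ℝ), F ((z.2 : ℝ) • (z.1 : Euc n))
      ∂(surf n).prod (.volumeIoiPow (n - 1)) := by
  have : Nonempty (Fin n) := ⟨⟨0, hn⟩⟩
  have h := (volume : Measure (Euc n)).measurePreserving_homeomorphUnitSphereProd.integral_comp
    (Homeomorph.measurableEmbedding _)
    (fun z : Sph n × Ioi (0 : ℝ) => F ((z.2 : ℝ) • (z.1 : Euc n)))
  rw [finrank_euclideanSpace_fin] at h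
  -- The polar homeomorphism lives on the punctured space; the removed origin is a null set.
  have h2 := integral_subtype_comap (μ := (volume : Measure (Euc n)))
    (measurableSet_singleton (0 : Euc n)).compl F
  rw [restrict_compl_singleton] at h2
  rw [← h, ← h2]
  refine integral_congr_ae (.of_forall fun x => ?_)
  have hx : ‖(x : Euc n)‖ ≠ 0 := norm_ne_zero_iff.2 x.2
  simp [smul_smul, hx]

/-- The integral over the cone of a sum of products of radial and angular functions. -/
theorem integral_conicalDomain {ι κ : Type*} [Fintype ι] [Fintype κ] (hn : 0 < n)
    (hlam : IsLocalization Λ lam lam₀) (hP : 0 < P) (hR : 0 < R) {G : Euc n → ℝ}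
    {q : ℝ → ι → ℝ} {s : Sph n → κ → ℝ} {M : ι → κ → ℝ}
    (hG : ∀ r, 0 < r → ∀ θ ∈ Λ, G (r • (θ : Euc n)) = ∑ k, ∑ j, M k j * (q r k * s θ j))
    (hq : ∀ k, IntegrableOn (fun r => q r k * r ^ ((n : ℝ) - 2 * p) * r ^ ((n : ℝ) - 1)) (Ioi R))
    (hs : ∀ j, Integrable (fun θ => s θ j) (chi lam P)) :
    ∫ x in conicalDomain Λ R, G x * omega p P lam x ^ 2 =
      ∑ k, ∑ j, M k j * ((∫ r in Ioi R, q r k * r ^ ((n : ℝ) - 2 * p) * r ^ ((n : ℝ) - 1)) *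
        ∫ θ, s θ j ∂chi lam P) := by
  have hmeas : MeasurableSet (conicalDomain Λ R) :=
    (isOpen_cone hlam.isOpen).measurableSet.inter measurableSet_closedBall.compl
  have hw : Measurable fun θ => ENNReal.ofReal (lam θ ^ (2 * P)) :=
    (hlam.continuous_weight hP.le).measurable.ennreal_ofReal
  have hw0 : ∀ θ, 0 ≤ lam θ ^ (2 * P) := fun θ => Real.rpow_nonneg (hlam.nonneg θ) _
  -- The cutoff at `R` and the radial weight go into `h`, the density of `dχ` into `t`, so that the
  -- integrand on the whole product space is a sum of `t` times `h`.
  let h : ι → ℝ → ℝ := fun k => (Ioi R).indicator fun r => q r k * r ^ ((n : ℝ) - 2 * p)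
  let t : κ → Sph n → ℝ := fun j θ => lam θ ^ (2 * P) * s θ j
  have ht : ∀ j, Integrable (t j) (surf n) := fun j => by
    have := hs j
    rw [chi, integrable_withDensity_iff_integrable_smul' hw (by simp)] at this
    refine this.congr (.of_forall fun θ => ?_)
    simp [t, ENNReal.toReal_ofReal (hw0 θ)]
  have ht2 : ∀ j, ∫ θ, t j θ ∂surf n = ∫ θ, s θ j ∂chi lam P := fun j => by
    rw [chi, integral_withDensity_eq_integral_toReal_smul hw (by simp)]
    refine integral_congr_ae (.of_forall fun θ => ?_)
    simp [t, ENNReal.toReal_ofReal (hw0 θ)]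
  have hpow : ∀ r : ℝ, r ^ (n - 1) = r ^ ((n : ℝ) - 1) := fun r => by
    rw [← Real.rpow_natCast, Nat.cast_sub hn, Nat.cast_one]
  have hh : ∀ k, (fun r => h k r * r ^ (n - 1)) =
      (Ioi R).indicator fun r => q r k * r ^ ((n : ℝ) - 2 * p) * r ^ ((n : ℝ) - 1) := fun k => by
    ext r
    by_cases hr : r ∈ Ioi R
    · simp only [h, indicator_of_mem hr, hpow]
    · simp only [h, indicator_of_notMem hr, zero_mul]
  have hh1 : ∀ k, Integrable (fun r : Ioi (0 : ℝ) => h k r) (.volumeIoiPow (n - 1)) := fun k => by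
    refine integrable_volumeIoiPow ?_
    rw [hh]
    exact ((hq k).integrable_indicator measurableSet_Ioi).integrableOn
  have hh2 : ∀ k, ∫ r : Ioi (0 : ℝ), h k r ∂.volumeIoiPow (n - 1) =
      ∫ r in Ioi R, q r k * r ^ ((n : ℝ) - 2 * p) * r ^ ((n : ℝ) - 1) := fun k => by
    rw [integral_volumeIoiPow, hh, setIntegral_indicator measurableSet_Ioi,
      inter_eq_right.2 (Ioi_subset_Ioi hR.le)]
  have key : ∀ z : Sph n × Ioi (0 : ℝ),
      (conicalDomain Λ R).indicator (fun x => G x * omega p P lam x ^ 2)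
        ((z.2 : ℝ) • (z.1 : Euc n)) = ∑ k, ∑ j, M k j * (t j z.1 * h k z.2) := by
    rintro ⟨θ, r, hr : 0 < r⟩
    by_cases hθ : θ ∈ Λ
    · have hc := (smul_mem_cone (Λ := Λ) hr θ).2 hθ
      by_cases hrR : R < r
      · have hmem : r • (θ : Euc n) ∈ conicalDomain Λ R := by
          refine ⟨hc, ?_⟩
          simpa [norm_smul, abs_of_pos hr] using hrR
        have hom : omega p P lam (r • (θ : Euc n)) ^ 2 =
            lam θ ^ (2 * P) * r ^ ((n : ℝ) - 2 * p) := by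
          rw [omega, ext_smul_coe lam hr, norm_smul_coe hr, mul_pow, ← Real.rpow_mul_natCast
            (hlam.nonneg θ), ← Real.rpow_mul_natCast hr.le]
          congr 2 <;> push_cast <;> ring
        rw [indicator_of_mem hmem, hG r hr θ hθ, hom, Finset.sum_mul]
        refine Finset.sum_congr rfl fun k _ => ?_
        rw [Finset.sum_mul]
        refine Finset.sum_congr rfl fun j _ => ?_
        simp only [h, t, indicator_of_mem (mem_Ioi.2 hrR)]
        ring
      · have hmem : r • (θ : Euc n) ∉ conicalDomain Λ R := by
          rintro ⟨-, h2⟩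
          simp [norm_smul, abs_of_pos hr] at h2
          exact hrR h2
        rw [indicator_of_notMem hmem]
        refine (Finset.sum_eq_zero fun k _ => Finset.sum_eq_zero fun j _ => ?_).symm
        simp only [h, indicator_of_notMem (show r ∉ Ioi R from hrR), mul_zero]
    · have hmem : r • (θ : Euc n) ∉ conicalDomain Λ R :=
        fun h2 => hθ ((smul_mem_cone hr θ).1 h2.1)
      rw [indicator_of_notMem hmem]
      refine (Finset.sum_eq_zero fun k _ => Finset.sum_eq_zero fun j _ => ?_).symm
      -- Outside `Λ` the weight is `0 ^ (2 * P)`, which is zero only because `P` is non-zero.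
      simp only [t, hlam.eq_zero θ hθ, Real.zero_rpow (mul_pos two_pos hP).ne', zero_mul, mul_zero]
  have hint : ∀ k j, Integrable (fun z : Sph n × Ioi (0 : ℝ) => M k j * (t j z.1 * h k z.2))
      ((surf n).prod (.volumeIoiPow (n - 1))) := fun k j =>
    ((ht j).mul_prod (hh1 k)).const_mul _
  rw [← integral_indicator hmeas, integral_polar hn]
  simp only [key]
  rw [integral_finsetSum _ fun k _ => integrable_finsetSum _ fun j _ => hint k j]
  refine Finset.sum_congr rfl fun k _ => ?_
  rw [integral_finsetSum _ fun j _ => hint k j]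
  refine Finset.sum_congr rfl fun j _ => ?_
  rw [integral_const_mul, integral_prod_mul (t j) (fun r : Ioi (0 : ℝ) => h k r), ht2, hh2]
  ring

end Integration

/-! ### Radial integration by parts -/

section Radial

variable {ψ : ℝ → ℝ} {R : ℝ}

/-- The support of `ψ` stays away from `r ≤ 0`, where the real power may fail to be smooth. -/
theorem contDiff_mul_rpow (hψ : ContDiff ℝ ∞ ψ) (hR : 0 < R) (hs : tsupport ψ ⊆ Ioi R) (s : ℝ) :
    ContDiff ℝ ∞ fun r => ψ r * r ^ s := by
  rw [contDiff_iff_contDiffAt]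
  intro r
  by_cases hr : 0 < r
  · exact hψ.contDiffAt.mul (Real.contDiffAt_rpow_const_of_ne hr.ne')
  · have hnot : r ∉ tsupport ψ := fun h => hr (hR.trans (hs h))
    refine (contDiffAt_const (c := (0 : ℝ))).congr_of_eventuallyEq ?_
    filter_upwards [notMem_tsupport_iff_eventuallyEq.1 hnot] with y hy
    simp [hy]

theorem integrable_mul_rpow (hψ : ContDiff ℝ ∞ ψ) (hc : HasCompactSupport ψ) (hR : 0 < R)
    (hs : tsupport ψ ⊆ Ioi R) (s : ℝ) : Integrable fun r => ψ r * r ^ s :=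
  (contDiff_mul_rpow hψ hR hs s).continuous.integrable_of_hasCompactSupport hc.mul_right

/-- Integration by parts without boundary terms: `ψ` vanishes at `R` and for large `r`. -/
theorem integral_deriv_mul_rpow (hψ : ContDiff ℝ ∞ ψ) (hc : HasCompactSupport ψ) (hR : 0 < R)
    (hs : tsupport ψ ⊆ Ioi R) (s : ℝ) :
    ∫ r in Ioi R, deriv ψ r * r ^ s = -s * ∫ r in Ioi R, ψ r * r ^ (s - 1) := by
  have hψ' : ContDiff ℝ ∞ (deriv ψ) := hψ.iterate_deriv 1
  have h := HasCompactSupport.integral_Ioi_deriv_eq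
    ((contDiff_mul_rpow hψ hR hs s).of_le (by norm_cast)) hc.mul_right R
  have h0 : ψ R = 0 := image_eq_zero_of_notMem_tsupport fun h => lt_irrefl R (hs h)
  have h1 : ∫ r in Ioi R, deriv (fun r => ψ r * r ^ s) r =
      ∫ r in Ioi R, (deriv ψ r * r ^ s + s * (ψ r * r ^ (s - 1))) := by
    refine setIntegral_congr_fun measurableSet_Ioi fun r hr => ?_
    have hr0 : r ≠ 0 := (hR.trans hr).ne'
    have := ((hψ.differentiable (by simp) r).hasDerivAt.mul
      (Real.hasDerivAt_rpow_const (p := s) (Or.inl hr0))).deriv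
    refine this.trans ?_
    ring
  rw [h1, integral_add, integral_const_mul, h0, zero_mul, neg_zero] at h
  · linarith
  · exact (integrable_mul_rpow hψ' hc.deriv hR
      (tsupport_deriv_subset.trans hs) s).integrableOn
  · exact ((integrable_mul_rpow hψ hc hR hs (s - 1)).const_mul s).integrableOn

end Radial

section Radial

variable {ψ : ℝ → ℝ} {R : ℝ} {n : ℕ} {p α : ℝ}

theorem rpow_mul_rpow_mul_rpow {r : ℝ} (hr : 0 < r) (y x a b c : ℝ) (h : a + b + c = x) :
    y * r ^ a * r ^ b * r ^ c = y * r ^ x := by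
  rw [← h, Real.rpow_add hr, Real.rpow_add hr]
  ring

/-- With `e = a - α`, the three radial integrands are `ψ'' r^(e+1)`, `ψ' r^e` and `ψ r^(e-1)`.
Integrating by parts twice, once and not at all reduces them to one integral, with factors `e(e+1)`,
`-e` and 1. -/
theorem integral_radialFactor (hψ : ContDiff ℝ ∞ ψ) (hc : HasCompactSupport ψ) (hR : 0 < R)
    (hs : tsupport ψ ⊆ Ioi R) (k : Fin 3) :
    IntegrableOn (fun r => radialFactor α ψ r k * r ^ ((n : ℝ) - 2 * p) * r ^ ((n : ℝ) - 1))
      (Ioi R) ∧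
    ∫ r in Ioi R, radialFactor α ψ r k * r ^ ((n : ℝ) - 2 * p) * r ^ ((n : ℝ) - 1) =
      ![(coefA n p - α) * (coefA n p - α + 1), -(coefA n p - α), 1] k *
        ∫ r in Ioi R, ψ r * r ^ (-4 - α) * r ^ ((n : ℝ) - 2 * p) * r ^ ((n : ℝ) - 1) := by
  set e := coefA n p - α with he
  have he' : e = 2 * ((n : ℝ) - 2 - p) - α := he
  have hψ' : ContDiff ℝ ∞ (deriv ψ) := hψ.iterate_deriv 1
  have hψ'' : ContDiff ℝ ∞ (deriv (deriv ψ)) := hψ'.iterate_deriv 1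
  have hs' : tsupport (deriv ψ) ⊆ Ioi R := tsupport_deriv_subset.trans hs
  have hs'' : tsupport (deriv (deriv ψ)) ⊆ Ioi R := tsupport_deriv_subset.trans hs'
  have e0 : ∫ r in Ioi R, ψ r * r ^ (-4 - α) * r ^ ((n : ℝ) - 2 * p) * r ^ ((n : ℝ) - 1) =
      ∫ r in Ioi R, ψ r * r ^ (e - 1) :=
    setIntegral_congr_fun measurableSet_Ioi fun r hr =>
      rpow_mul_rpow_mul_rpow (hR.trans hr) _ _ _ _ _ (by rw [he']; ring)
  have h1 := integral_deriv_mul_rpow hψ hc hR hs e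
  have h2 := integral_deriv_mul_rpow hψ' hc.deriv hR hs' (e + 1)
  rw [add_sub_cancel_right, h1] at h2
  -- Here `2n - 2p - 1` is the total exponent of the radial weight and the polar volume element.
  have main : ∀ (y : ℝ → ℝ) (x s : ℝ), -α - x + (2 * n - 2 * p - 1) = s →
      Integrable (fun r => y r * r ^ s) →
      IntegrableOn (fun r => y r * r ^ (-α - x) * r ^ ((n : ℝ) - 2 * p) * r ^ ((n : ℝ) - 1))
        (Ioi R) ∧
      ∫ r in Ioi R, y r * r ^ (-α - x) * r ^ ((n : ℝ) - 2 * p) * r ^ ((n : ℝ) - 1) =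
        ∫ r in Ioi R, y r * r ^ s := by
    intro y x s hx hy
    have hcongr : ∀ r ∈ Ioi R, y r * r ^ (-α - x) * r ^ ((n : ℝ) - 2 * p) * r ^ ((n : ℝ) - 1) =
        y r * r ^ s := fun r hr =>
      rpow_mul_rpow_mul_rpow (hR.trans hr) _ _ _ _ _ (by rw [← hx]; ring)
    exact ⟨hy.integrableOn.congr_fun (fun r hr => (hcongr r hr).symm) measurableSet_Ioi,
      setIntegral_congr_fun measurableSet_Ioi hcongr⟩
  rw [e0]
  fin_cases k
  · obtain ⟨h3, h4⟩ := main (deriv (deriv ψ)) 2 (e + 1) (by rw [he']; ring)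
      (integrable_mul_rpow hψ'' hc.deriv.deriv hR hs'' _)
    refine ⟨h3, h4.trans (h2.trans ?_)⟩
    simp
    ring
  · obtain ⟨h3, h4⟩ := main (deriv ψ) 3 e (by rw [he']; ring)
      (integrable_mul_rpow hψ' hc.deriv hR hs' _)
    exact ⟨h3, h4.trans h1⟩
  · obtain ⟨h3, h4⟩ := main ψ 4 (e - 1) (by rw [he']; ring) (integrable_mul_rpow hψ hc hR hs _)
    exact ⟨h3, h4.trans (one_mul _).symm⟩

end Radial

/-! ### Assembly of the variational identity -/

section Variational

variable {n : ℕ} {Λ : Set (Sph n)} {lam : Sph n → ℝ} {lam₀ P p α R : ℝ}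

theorem integral_eq_pairing {V : Type} [NormedAddCommGroup V] [InnerProductSpace ℝ V]
    (S T : H2 Λ lam P →L[ℝ] Lp V 2 (chi lam P)) (ν μ : H2 Λ lam P) {s : Sph n → ℝ}
    (h : (fun θ => inner ℝ (S ν θ) (T μ θ)) =ᵐ[chi lam P] s) :
    Integrable s (chi lam P) ∧ ∫ θ, s θ ∂chi lam P = pairing S T ν μ :=
  ⟨(L2.integrable_inner (S ν) (T μ)).congr h,
    (integral_congr_ae h).symm.trans (pairing_apply S T ν μ).symm⟩

theorem integral_sphProducts {ν μ : H2 Λ lam P} {f g : Sph n → ℝ} (hf : IsSmoothFun ν f)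
    (hg : IsSmoothFun μ g) (j : Fin 6) :
    Integrable (fun θ => sphProducts f g θ j) (chi lam P) ∧
    ∫ θ, sphProducts f g θ j ∂chi lam P = ![pairing val val ν μ, pairing lap val ν μ,
      pairing val lap ν μ, pairing lap lap ν μ, pairing grad grad ν μ, pairing hess hess ν μ] j := by
  fin_cases j
  · refine integral_eq_pairing val val ν μ ?_
    filter_upwards [hf.val_ae, hg.val_ae] with θ h1 h2
    rw [h1, h2]
    exact mul_comm _ _
  · refine integral_eq_pairing lap val ν μ ?_
    filter_upwards [hf.lap_ae, hg.val_ae] with θ h1 h2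
    rw [h1, h2]
    exact mul_comm _ _
  · refine integral_eq_pairing val lap ν μ ?_
    filter_upwards [hf.val_ae, hg.lap_ae] with θ h1 h2
    rw [h1, h2]
    exact mul_comm _ _
  · refine integral_eq_pairing lap lap ν μ ?_
    filter_upwards [hf.lap_ae, hg.lap_ae] with θ h1 h2
    rw [h1, h2]
    exact mul_comm _ _
  · refine integral_eq_pairing grad grad ν μ ?_
    filter_upwards [hf.grad_ae, hg.grad_ae] with θ h1 h2
    rw [h1, h2, PiLp.inner_apply]
    exact Finset.sum_congr rfl fun i _ => mul_comm _ _
  · refine integral_eq_pairing hess hess ν μ ?_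
    filter_upwards [hf.hess_ae, hg.hess_ae] with θ h1 h2
    rw [h1, h2, PiLp.inner_apply, Fintype.sum_prod_type]
    exact Finset.sum_congr rfl fun i _ => Finset.sum_congr rfl fun j _ => mul_comm _ _

/-- Substituting the radial factors into the table of polar coefficients turns the variational
identity into a polynomial identity, with the six pairings as free variables. -/
theorem hamOp_algebra (m a I x₀ x₁ x₂ x₃ x₄ x₅ : ℝ) :
    ∑ k, ∑ j, polarCoef m α k j * (![(a - α) * (a - α + 1), -(a - α), 1] k * I *
        ![x₀, x₁, x₂, x₃, x₄, x₅] j) =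
      I * ((m - 2) * x₃ + x₅ + 2 * (a + 1 + α * (a - α)) * x₄
        - (a - α) * ((m - 2) * (m - 2 - a + α) + 1) * x₁
        - α * ((m - 2) * (m - 2 - α) + 1) * x₂
        + (m - 1) * (α * (a - α)) * (α * (a - α) + (2 + (m - 3) * (m - 2 - a))) * x₀) := by
  simp only [Fin.sum_univ_three, Fin.sum_univ_six, polarCoef, Matrix.cons_val]
  ring

/-- The operators are those obtained from the squared localized Hamiltonian operator. -/
theorem isHamiltonianAt_hamOp (hn : 0 < n) (hlam : IsLocalization Λ lam lam₀) (hP : 0 < P)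
    (hR : 0 < R) : IsHamiltonianAt p P Λ lam R α (hamOp p P Λ lam α) := by
  intro ν μ f g hf hg ψ hψ hc hs
  have h0 := (hlam.chi_real_univ_pos hP.le).ne'
  have h := integral_conicalDomain (p := p) (q := radialFactor α ψ) (s := sphProducts f g)
    (M := polarCoef n α) (G := fun x => ∑ i, ∑ j, dHstar (fun y => ‖y‖ ^ (-α) * ext f y) x i j *
      dHstar (fun y => ψ ‖y‖ * ext g y) x i j) hn hlam hP hR
    (fun r hr θ hθ => sum_dHstar_mul_dHstar hlam.isOpen hf.1 hg.1 hθ hr α hψ)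
    (fun k => (integral_radialFactor hψ hc hR hs k).1)
    (fun j => (integral_sphProducts hf hg j).1)
  rw [hamVar, h, hamOp_apply, mul_inv_cancel_left₀ h0]
  simp only [fun k => (integral_radialFactor (n := n) (p := p) (α := α) hψ hc hR hs k).2,
    fun j => (integral_sphProducts hf hg j).2]
  exact hamOp_algebra n (coefA n p) _ _ _ _ _ _ _

end Variational

end HarmonicHamiltonian

end

open HarmonicHamiltonian in
theorem mainTheorem9 (n : ℕ) (hn : 3 ≤ n) (p : ℝ) (hp : p ∈ Set.Ioo (0 : ℝ) ((n : ℝ) - 2))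
    (P : ℝ) (hP : 2 ≤ P) (R : ℝ) (hR : 0 < R)
    (Λ : Set (Sph n)) (lam : Sph n → ℝ) (lam₀ : ℝ) (hlam : IsLocalization Λ lam lam₀)
    (hstab : HarmonicStability p P Λ lam) :
    -- the operators are those obtained from the squared localized Hamiltonian operator
    (∀ α ∈ Set.Icc (coefA n p / 2) (coefA n p),
      IsHamiltonianAt p P Λ lam R α (hamOp p P Λ lam α)) ∧
    -- sub-harmonic exponents
    (∀ α ∈ Set.Ico (coefA n p / 2) (coefA n p),
      Function.Bijective (hamOp p P Λ lam α) ∧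
      (hamOp p P Λ lam α).ker = ⊥ ∧ (hamOp p P Λ lam α).flip.ker = ⊥) ∧
    -- harmonic exponent: the cokernel
    (∃ one : H2 Λ lam P, IsSmoothFun one (fun _ => 1) ∧ one ≠ 0 ∧
      (hamOp p P Λ lam (coefA n p)).flip.ker = Submodule.span ℝ {one} ∧
      ∀ F : H2 Λ lam P →L[ℝ] ℝ,
        (∃ ν, hamOp p P Λ lam (coefA n p) ν = F) ↔ F one = 0) ∧
    -- harmonic exponent: the kernel
    (∀ ν : H2 Λ lam P, hamOp p P Λ lam (coefA n p) ν = 0 → ν ≠ 0 →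
      ⨍ θ, (lap ν θ - coefD n p * val ν θ) ∂(chi lam P) ≠ 0) ∧
    (∃ νnorm : H2 Λ lam P, νnorm ≠ 0 ∧
      (hamOp p P Λ lam (coefA n p)).ker = Submodule.span ℝ {νnorm} ∧
      ⨍ θ, (lap νnorm θ - coefD n p * val νnorm θ) ∂(chi lam P) = zeta P lam ∧
      ∀ ν : H2 Λ lam P, hamOp p P Λ lam (coefA n p) ν = 0 →
        ⨍ θ, (lap ν θ - coefD n p * val ν θ) ∂(chi lam P) = zeta P lam → ν = νnorm) := by
  have hP0 : 0 < P := by linarith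
  have ha : coefA n p ∈ Set.Icc (coefA n p / 2) (coefA n p) := by
    have : 0 ≤ coefA n p := by have := hp.2; simp only [coefA]; linarith
    exact ⟨by linarith, le_rfl⟩
  obtain ⟨one, hone, hne⟩ := hlam.exists_one hP0.le
  obtain ⟨C, hC, hB⟩ := hstab.coercive ha one hone
  have he := averageFunctional_one_ne_zero hstab hn hp.1 hlam hP0.le ha one hone
  have hBe := hamOp_harmonic_one_eq_zero (P := P) (Λ := Λ) (lam := lam) hn hp one hone
  -- At `α = a` the constant `D^α` is `d`, so the hyperplane functional is the normalizing average
  -- of the conclusion.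
  rw [← coefD_eq] at hB he
  simp only [← averageFunctional_apply one hone]
  exact ⟨fun α _ => isHamiltonianAt_hamOp (by omega) hlam hP0 hR,
    fun α hα => hamOp_bijective hstab hn hp.1 hlam hP0.le hα,
    ⟨one, hone, hne, flip_ker_of_coercive_on_ker hB he hBe,
      range_iff_of_coercive_on_ker hC hB he hBe⟩,
    fun ν hν hν0 => apply_ne_zero_of_mem_ker hB hν hν0,
    exists_ker_generator hC hB he hBe (zeta_ne_zero hlam hP0.le)⟩
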